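/- **Setting.** Let $d\in\mathbb N$, $T>0$, and let $U$ be a nonempty metric space. For $t\in[0,T]$ let $\hat\Lambda_t$ be the set of càdlàg functions and $\Lambda_t$ the set of continuous functions $[0,t]\to\mathbb R^d$; put $\hat\Lambda^t=\bigcup_{s\in[t,T]}\hat\Lambda_s$, $\Lambda^t=\bigcup_{s\in[t,T]}\Lambda_s$, $\Lambda=\Lambda^0$, $\hat\Lambda=\hat\Lambda^0$. A path with final time $t$ is written $\gamma_t$; $\|\gamma_t\|_0=\sup_{s\le t}|\gamma_t(s)|$ and, for $t\le r$, $$d_\infty(\gamma_t,\eta_r)=|t-r|+\sup_{0\le s\le r}|\gamma_t(s\wedge t)-\eta_r(s)|.$$ $C^0$ means continuous for $d_\infty$. For $r\ge t$, $\gamma_{t,r}\in\hat\Lambda_r$ is $\gamma_t$ extended by the constant $\gamma_t(t)$ on $(t,r]$, and $\gamma_t^x$ is $\gamma_t$ with its value at time $t$ replaced by $\gamma_t(t)+x$. *Pathwise derivatives.* For $f:\hat\Lambda^t\to\mathbb R$, $\partial_tf(\gamma_s)=\lim_{h\downarrow0}\frac1h[f(\gamma_{s,s+h})-f(\gamma_s)]$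 for $s<T$, $\partial_tf(\gamma_T)=\lim_{s\uparrow T}\partial_tf(\gamma_T|_{[0,s]})$, and $\partial_{x_i}f(\gamma_s)=\lim_{h\to0}\frac1h[f(\gamma_s^{he_i})-f(\gamma_s)]$. We write $f\in C^1(\hat\Lambda^t)$ if $f,\partial_tf,\partial_{x_1}f,\dots,\partial_{x_d}f$ exist and are $C^0$ on $\hat\Lambda^t$, and $\varphi\in C^1(\Lambda^t)$ if $\varphi$ is the restriction to $\Lambda^t$ of some $f\in C^1(\hat\Lambda^t)$; then $\partial_t\varphi:=\partial_tf$, $\partial_x\varphi:=\partial_xf$ on $\Lambda^t$ (independent of the choice of $f$). *Coefficients.* $F:\Lambda\times U\to\mathbb R^d$, $q:\Lambda\times U\to\mathbb R$ and $\phi:\Lambda_T\to\mathbb R$ are continuous, and there is a constant $L_0>0$ such that for all $t\in[0,T]$, $\gamma_t,\gamma'_t\in\Lambda_t$, $u\in U$ and $\eta_T,\eta'_T\in\Lambda_T$, $$|F(\gamma_t,u)-F(\gamma_t',u)|\vee|q(\gamma_t,u)-q(\gamma_t',u)|\le L_0\|\gamma_t-\gamma'_t\|_0,\qquad |F(\gamma_t,u)|\vee|q(\gamma_t,u)|\le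 L_0(1+\|\gamma_t\|_0),$$ $$|\phi(\eta_T)-\phi(\eta_T')|\le L_0\|\eta_T-\eta_T'\|_0,\qquad |\phi(\eta_T)|\le L_0(1+\|\eta_T\|_0).$$ With $\mathbf H(\gamma_t,p)=\inf_{u\in U}[(p,F(\gamma_t,u))+q(\gamma_t,u)]$, the path-dependent HJB (PHJB) equation is $$\partial_tV(\gamma_t)+\mathbf H(\gamma_t,\partial_xV(\gamma_t))=0\ \ (t<T),\qquad V(\gamma_T)=\phi(\gamma_T).$$ *Viscosity solutions.* For $\mu,M>0$ let $\mathcal C^\mu_{t,M}$ be the set of $\gamma_s\in\Lambda^t$ with $\|\gamma_s\|_0\le M$ and $\sup_{0\le l<r\le s}\frac{|\gamma_s(l)-\gamma_s(r)|}{|l-r|}\le\mu(1+M)$. A function $w\in C^0(\Lambda)$ is a viscosity $\mu$-subsolution if $w\le\phi$ on $\Lambda_T$ and, for every $M>0$, $s\in[0,T)$, $\gamma_s\in\mathcal C^\mu_{0,M}$ with $|\gamma_s(s)|<M$, and every $\varphi\in C^1(\Lambda^s)$ with $0=(w-\varphi)(\gamma_s)=\sup_{\mathcal C^\mu_{s,M}}(w-\varphi)$,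 $$\partial_t\varphi(\gamma_s)+\mathbf H(\gamma_s,\partial_x\varphi(\gamma_s))\ge0.$$ It is a viscosity $\mu$-supersolution if $w\ge\phi$ on $\Lambda_T$ and, for all such $M,s,\gamma_s$ and every $\varphi\in C^1(\Lambda^s)$ with $0=(w+\varphi)(\gamma_s)=\inf_{\mathcal C^\mu_{s,M}}(w+\varphi)$, $$-\partial_t\varphi(\gamma_s)+\mathbf H(\gamma_s,-\partial_x\varphi(\gamma_s))\le0.$$ It is a viscosity subsolution (supersolution) if there is $\mu_0>0$ such that it is a viscosity $\mu$-subsolution ($\mu$-supersolution) for all $\mu\ge\mu_0$. **Theorem (comparison principle).** Let $W_1\in C^0(\Lambda)$ be a viscosity subsolution and $W_2\in C^0(\Lambda)$ a viscosity supersolution of the PHJB equation, and suppose there is a constant $L>0$ such that, for $i=1,2$ and all $\gamma_t,\eta_s\in\Lambda$, $$|W_i(\gamma_t)|\le L(1+\|\gamma_t\|_0),\qquad |W_i(\gamma_t)-W_i(\eta_s)|\le L\,(1+\|\gamma_t\|_0\vee\|\eta_s\|_0)\,d_\infty(\gamma_t,\eta_s).$$ Then $W_1(\gamma_t)\le W_2(\gamma_t)$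 for all $\gamma_t\in\Lambda$. -/

import Mathlib

open Set Filter Topology

namespace PHJB

/-- An element `γ_t` of `Λ̂`, the union over `t ∈ [0, T]` of the spaces of càdlàg functions
`[0, t] → ℝᵈ`. The final time `t` is part of the data. The function on `[0, t]` is stored through
its unique extension to `ℝ` that is constant on `(-∞, 0]` and on `[t, ∞)`, so that
`γ_t (s ∧ t)` is just the value at `s`; the two conditions below (right continuity everywhere,
left limits everywhere) then say exactly that the function on `[0, t]` is càdlàg. A jump at the
final time is allowed. -/
@[ext]
structure CadlagPath (d : ℕ) (T : ℝ) where
  /-- the final time `t` of the path -/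
  time : ℝ
  /-- the values of the path -/
  toFun : ℝ → EuclideanSpace ℝ (Fin d)
  time_mem : time ∈ Icc (0 : ℝ) T
  const_left : ∀ s, s ≤ 0 → toFun s = toFun 0
  const_right : ∀ s, time ≤ s → toFun s = toFun time
  right_cont : ∀ s, ContinuousWithinAt toFun (Ici s) s
  left_lim : ∀ s, ∃ l, Tendsto toFun (𝓝[<] s) (𝓝 l)

variable {d : ℕ} {T : ℝ}

namespace CadlagPath

theorem toFun_clamp (γ : CadlagPath d T) (s : ℝ) :
    γ.toFun s = γ.toFun (max 0 (min s γ.time)) := by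
  have h0 := γ.time_mem.1
  rcases le_total s 0 with h | h
  · rw [γ.const_left s h, min_eq_left (h.trans h0), max_eq_left h]
  · rcases le_total s γ.time with h1 | h1
    · rw [min_eq_left h1, max_eq_right h]
    · rw [min_eq_right h1, max_eq_right h0, γ.const_right s h1]

/-- Càdlàg functions on a compact interval are bounded. -/
theorem exists_bound (γ : CadlagPath d T) : ∃ C, ∀ s, ‖γ.toFun s‖ ≤ C := by
  have hloc : ∀ x ∈ Icc (0 : ℝ) γ.time, ∃ t ∈ 𝓝[Icc (0 : ℝ) γ.time] x,
      ∃ C, ∀ s ∈ t, ‖γ.toFun s‖ ≤ C := by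
    intro x _
    obtain ⟨l, hl⟩ := γ.left_lim x
    have h1 : ∀ᶠ s in 𝓝[<] x, ‖γ.toFun s‖ < ‖l‖ + 1 :=
      hl.norm.eventually (gt_mem_nhds (lt_add_one _))
    have h2 : ∀ᶠ s in 𝓝[≥] x, ‖γ.toFun s‖ < ‖γ.toFun x‖ + 1 :=
      (γ.right_cont x).norm.eventually (gt_mem_nhds (lt_add_one _))
    refine ⟨{s | ‖γ.toFun s‖ ≤ max (‖l‖ + 1) (‖γ.toFun x‖ + 1)}, ?_, _, fun s hs => hs⟩
    apply mem_nhdsWithin_of_mem_nhds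
    rw [← nhdsLT_sup_nhdsGE]
    refine ⟨?_, ?_⟩
    · filter_upwards [h1] with s hs using hs.le.trans (le_max_left _ _)
    · filter_upwards [h2] with s hs using hs.le.trans (le_max_right _ _)
  have h : ∃ C, ∀ s ∈ Icc (0 : ℝ) γ.time, ‖γ.toFun s‖ ≤ C := by
    refine isCompact_Icc.induction_on (p := fun A => ∃ C, ∀ s ∈ A, ‖γ.toFun s‖ ≤ C)
      ⟨0, by simp⟩ ?_ ?_ hloc
    · rintro A B hAB ⟨C, hC⟩
      exact ⟨C, fun s hs => hC s (hAB hs)⟩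
    · rintro A B ⟨C, hC⟩ ⟨D, hD⟩
      refine ⟨max C D, ?_⟩
      rintro s (hs | hs)
      · exact (hC s hs).trans (le_max_left _ _)
      · exact (hD s hs).trans (le_max_right _ _)
  obtain ⟨C, hC⟩ := h
  refine ⟨C, fun s => ?_⟩
  rw [γ.toFun_clamp s]
  exact hC _ ⟨le_max_left _ _, max_le γ.time_mem.1 (min_le_right _ _)⟩

/-- `‖γ_t‖₀ = sup_{0 ≤ s ≤ t} |γ_t(s)|` (the extension takes no further values). -/
noncomputable def supNorm (γ : CadlagPath d T) : ℝ := ⨆ s : ℝ, ‖γ.toFun s‖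

/-- `sup_s |γ_t(s ∧ t) - η_r(s ∧ r)|`; for paths with the same final time this is
`‖γ_t - η_t‖₀`. -/
noncomputable def supDist (γ η : CadlagPath d T) : ℝ := ⨆ s : ℝ, ‖γ.toFun s - η.toFun s‖

theorem bddAbove_sub (γ η : CadlagPath d T) :
    BddAbove (range fun s : ℝ => ‖γ.toFun s - η.toFun s‖) := by
  obtain ⟨C, hC⟩ := γ.exists_bound
  obtain ⟨D, hD⟩ := η.exists_bound
  refine ⟨C + D, ?_⟩
  rintro _ ⟨s, rfl⟩
  exact (norm_sub_le _ _).trans (add_le_add (hC s) (hD s))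

theorem norm_sub_le_supDist (γ η : CadlagPath d T) (s : ℝ) :
    ‖γ.toFun s - η.toFun s‖ ≤ supDist γ η :=
  le_ciSup (bddAbove_sub γ η) s

theorem supDist_nonneg (γ η : CadlagPath d T) : 0 ≤ supDist γ η :=
  (norm_nonneg _).trans (norm_sub_le_supDist γ η 0)

/-- The metric `d_∞(γ_t, η_r) = |t - r| + sup_s |γ_t(s ∧ t) - η_r(s ∧ r)|` on `Λ̂`. -/
noncomputable instance : MetricSpace (CadlagPath d T) where
  dist γ η := |γ.time - η.time| + supDist γ η
  dist_self γ := by simp [supDist]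
  dist_comm γ η := by
    simp only [supDist, abs_sub_comm γ.time, norm_sub_rev (γ.toFun _)]
  dist_triangle γ η ξ := by
    have h1 := abs_sub_le γ.time η.time ξ.time
    have h2 : supDist γ ξ ≤ supDist γ η + supDist η ξ :=
      ciSup_le fun s => (norm_sub_le_norm_sub_add_norm_sub _ (η.toFun s) _).trans
        (add_le_add (norm_sub_le_supDist γ η s) (norm_sub_le_supDist η ξ s))
    linarith
  eq_of_dist_eq_zero {γ η} h := by
    change |γ.time - η.time| + supDist γ η = 0 at h
    have h1 := abs_nonneg (γ.time - η.time)
    have h2 := supDist_nonneg γ η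
    refine CadlagPath.ext ?_ (funext fun s => ?_)
    · exact sub_eq_zero.1 (abs_eq_zero.1 (by linarith))
    · have h3 := norm_sub_le_supDist γ η s
      exact sub_eq_zero.1 (norm_eq_zero.1 (le_antisymm (by linarith) (norm_nonneg _)))

theorem dist_def (γ η : CadlagPath d T) : dist γ η = |γ.time - η.time| + supDist γ η := rfl

/-- The frozen extension `γ_{t, r}` of `γ_t`, for `r ∈ [t, T]`: the path with final time `r` that
stays at `γ_t(t)` on `(t, r]`. (For other `r` the final time is `r` projected onto `[t, T]`.) -/
noncomputable def freeze (γ : CadlagPath d T) (r : ℝ) : CadlagPath d T where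
  time := max γ.time (min r T)
  toFun := γ.toFun
  time_mem := ⟨γ.time_mem.1.trans (le_max_left _ _), max_le γ.time_mem.2 (min_le_right _ _)⟩
  const_left := γ.const_left
  const_right s hs := by
    rw [γ.const_right s ((le_max_left _ _).trans hs), γ.const_right _ (le_max_left _ _)]
  right_cont := γ.right_cont
  left_lim := γ.left_lim

/-- The restriction `γ_t|_{[0, r]}`, for `r ∈ [0, t]`. (For other `r` the final time is `r`
projected onto `[0, t]`.) -/
noncomputable def restrict (γ : CadlagPath d T) (r : ℝ) : CadlagPath d T where
  time := max 0 (min r γ.time)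
  toFun s := γ.toFun (min s (max 0 (min r γ.time)))
  time_mem := ⟨le_max_left _ _,
    (max_le γ.time_mem.1 (min_le_right _ _)).trans γ.time_mem.2⟩
  const_left s hs := by
    have h : (0 : ℝ) ≤ max 0 (min r γ.time) := le_max_left _ _
    rw [min_eq_left (hs.trans h), min_eq_left h, γ.const_left s hs]
  const_right s hs := by rw [min_eq_right hs, min_self]
  right_cont s := by
    refine ContinuousWithinAt.comp (t := Ici (min s (max 0 (min r γ.time))))
      (γ.right_cont _) ?_ ?_
    · exact (continuous_id.min continuous_const).continuousWithinAt
    · intro u hu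
      exact min_le_min_right _ (mem_Ici.1 hu)
  left_lim s := by
    rcases le_or_gt s (max 0 (min r γ.time)) with h | h
    · obtain ⟨l, hl⟩ := γ.left_lim s
      refine ⟨l, hl.congr' ?_⟩
      filter_upwards [self_mem_nhdsWithin] with u hu
      rw [min_eq_left ((mem_Iio.1 hu).le.trans h)]
    · refine ⟨γ.toFun (max 0 (min r γ.time)), tendsto_const_nhds.congr' ?_⟩
      filter_upwards [mem_nhdsWithin_of_mem_nhds (Ioi_mem_nhds h)] with u hu
      rw [min_eq_right (mem_Ioi.1 hu).le]

/-- The vertical bump `γ_t^x`: equal to `γ_t` on `[0, t)` and to `γ_t(t) + x` at time `t`.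
(The maximum with `0` only matters for the constant extension to negative arguments when
`t = 0`.) -/
noncomputable def bump (γ : CadlagPath d T) (x : EuclideanSpace ℝ (Fin d)) : CadlagPath d T where
  time := γ.time
  toFun s := γ.toFun s + if γ.time ≤ max s 0 then x else 0
  time_mem := γ.time_mem
  const_left s hs := by rw [γ.const_left s hs, max_eq_right hs, max_self]
  const_right s hs := by
    have h1 : γ.time ≤ max s 0 := hs.trans (le_max_left _ _)
    have h2 : γ.time ≤ max γ.time 0 := le_max_left _ _
    rw [γ.const_right s hs, if_pos h1, if_pos h2]
  right_cont s := by
    refine (γ.right_cont s).add ?_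
    refine continuousWithinAt_const.congr_of_eventuallyEq
      (f := fun _ => if γ.time ≤ max s 0 then x else 0) ?_ rfl
    by_cases h : γ.time ≤ max s 0
    · filter_upwards [self_mem_nhdsWithin] with u hu
      rw [if_pos h, if_pos (h.trans (max_le_max_right 0 hu))]
    · have hc : ContinuousAt (fun u : ℝ => max u 0) s :=
        (continuous_id.max continuous_const).continuousAt
      filter_upwards [mem_nhdsWithin_of_mem_nhds (hc.eventually (gt_mem_nhds (not_le.1 h)))]
        with u hu
      rw [if_neg h, if_neg (not_le.2 hu)]
  left_lim s := by
    obtain ⟨l, hl⟩ := γ.left_lim s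
    rcases γ.time_mem.1.eq_or_lt with h0 | h0
    · refine ⟨l + x, (hl.add tendsto_const_nhds).congr fun u => ?_⟩
      rw [if_pos (h0 ▸ le_max_right _ _)]
    · rcases le_or_gt s γ.time with h | h
      · refine ⟨l + 0, (hl.add tendsto_const_nhds).congr' ?_⟩
        filter_upwards [self_mem_nhdsWithin] with u hu
        rw [if_neg (not_le.2 (max_lt ((mem_Iio.1 hu).trans_le h) h0))]
      · refine ⟨l + x, (hl.add tendsto_const_nhds).congr' ?_⟩
        filter_upwards [mem_nhdsWithin_of_mem_nhds (Ioi_mem_nhds h)] with u hu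
        rw [if_pos ((mem_Ioi.1 hu).le.trans (le_max_left _ _))]

end CadlagPath

/-- `Λ̂ᵗ`: the càdlàg paths whose final time lies in `[t, T]`. -/
def cadlagFrom (d : ℕ) (T t : ℝ) : Set (CadlagPath d T) := {γ | t ≤ γ.time}

/-- `f ∈ C¹(Λ̂ᵗ)` with horizontal derivative `ft` and vertical derivative `fx`: the three are
continuous on `Λ̂ᵗ` for `d_∞`, and `ft`, `fx` are the pathwise (Dupire) derivatives of `f` at every
point of `Λ̂ᵗ`, the horizontal one at the final time `T` being the limit of the horizontal
derivatives along the restrictions. Values of `f`, `ft`, `fx` outside `Λ̂ᵗ` play no role. -/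
structure HasPathDerivs (t : ℝ) (f ft : CadlagPath d T → ℝ)
    (fx : CadlagPath d T → EuclideanSpace ℝ (Fin d)) : Prop where
  continuousOn : ContinuousOn f (cadlagFrom d T t)
  continuousOn_horizontal : ContinuousOn ft (cadlagFrom d T t)
  continuousOn_vertical : ContinuousOn fx (cadlagFrom d T t)
  horizontal : ∀ γ ∈ cadlagFrom d T t, γ.time < T →
    Tendsto (fun h : ℝ => h⁻¹ * (f (γ.freeze (γ.time + h)) - f γ)) (𝓝[>] 0) (𝓝 (ft γ))
  horizontal_terminal : ∀ γ ∈ cadlagFrom d T t, γ.time = T →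
    Tendsto (fun s : ℝ => ft (γ.restrict s)) (𝓝[<] T) (𝓝 (ft γ))
  vertical : ∀ γ ∈ cadlagFrom d T t, ∀ i : Fin d,
    Tendsto (fun h : ℝ => h⁻¹ * (f (γ.bump (h • EuclideanSpace.single i (1 : ℝ))) - f γ))
      (𝓝[≠] 0) (𝓝 (fx γ i))

/-- `Λ`: the continuous paths, a subspace of `Λ̂` with the metric `d_∞`. -/
abbrev ContPath (d : ℕ) (T : ℝ) : Type := {γ : CadlagPath d T // Continuous γ.toFun}

/-- The continuous paths defined on the whole of `[0, T]`. -/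
abbrev TerminalPath (d : ℕ) (T : ℝ) : Type := {γ : ContPath d T // γ.1.time = T}

/-- `φ ∈ C¹(Λᵗ)`, with pathwise derivatives `φt`, `φx` : `φ` is on `Λᵗ` the restriction of some
functional in `C¹(Λ̂ᵗ)`, whose derivatives are `φt`, `φx`. (On `Λᵗ` these derivatives do not depend
on the choice of the extension.) -/
def HasPathDerivsCont (t : ℝ) (φ : ContPath d T → ℝ) (φt : CadlagPath d T → ℝ)
    (φx : CadlagPath d T → EuclideanSpace ℝ (Fin d)) : Prop :=
  ∃ f : CadlagPath d T → ℝ, HasPathDerivs t f φt φx ∧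
    ∀ γ : ContPath d T, t ≤ γ.1.time → f γ.1 = φ γ

/-- The class `C¹(Λᵗ)`. -/
def C1Cont (d : ℕ) (T t : ℝ) : Set (ContPath d T → ℝ) :=
  {φ | ∃ φt φx, HasPathDerivsCont t φ φt φx}

/-- The set of `γ_s ∈ Λᵗ` with `‖γ_s‖₀ ≤ M` that are Lipschitz on `[0, s]` with constant
`μ (1 + M)`. -/
def lipPaths (d : ℕ) (T μ t M : ℝ) : Set (ContPath d T) :=
  {γ | t ≤ γ.1.time ∧ γ.1.supNorm ≤ M ∧
    ∀ l r : ℝ, 0 ≤ l → l < r → r ≤ γ.1.time →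
      ‖γ.1.toFun l - γ.1.toFun r‖ / |l - r| ≤ μ * (1 + M)}

/-- `J⁺`: the `C¹` test functionals touching `w` from above at `γ_t`, relative to the paths in
`lipPaths` that end at or after time `t`. -/
def testAbove (μ M : ℝ) (γ : ContPath d T) (w : ContPath d T → ℝ) : Set (ContPath d T → ℝ) :=
  {φ | φ ∈ C1Cont d T γ.1.time ∧ w γ - φ γ = 0 ∧
    IsLUB ((fun η => w η - φ η) '' lipPaths d T μ γ.1.time M) 0}

/-- `J⁻`: the `C¹` functionals `φ` such that `-φ` touches `w` from below at `γ_t`, relative to the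
paths in `lipPaths` that end at or after time `t`. -/
def testBelow (μ M : ℝ) (γ : ContPath d T) (w : ContPath d T → ℝ) : Set (ContPath d T → ℝ) :=
  {φ | φ ∈ C1Cont d T γ.1.time ∧ w γ + φ γ = 0 ∧
    IsGLB ((fun η => w η + φ η) '' lipPaths d T μ γ.1.time M) 0}

/-- The standing assumptions on the coefficients, with constant `L`. -/
structure Coefficients {U : Type*} [MetricSpace U]
    (F : ContPath d T → U → EuclideanSpace ℝ (Fin d)) (q : ContPath d T → U → ℝ)
    (ϕ : TerminalPath d T → ℝ) (L : ℝ) : Prop where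
  continuous_F : Continuous fun p : ContPath d T × U => F p.1 p.2
  continuous_q : Continuous fun p : ContPath d T × U => q p.1 p.2
  continuous_terminal : Continuous ϕ
  lipschitz_F : ∀ (γ η : ContPath d T) (u : U), γ.1.time = η.1.time →
    ‖F γ u - F η u‖ ≤ L * γ.1.supDist η.1
  lipschitz_q : ∀ (γ η : ContPath d T) (u : U), γ.1.time = η.1.time →
    |q γ u - q η u| ≤ L * γ.1.supDist η.1
  growth_F : ∀ (γ : ContPath d T) (u : U), ‖F γ u‖ ≤ L * (1 + γ.1.supNorm)
  growth_q : ∀ (γ : ContPath d T) (u : U), |q γ u| ≤ L * (1 + γ.1.supNorm)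
  lipschitz_terminal : ∀ γ η : TerminalPath d T, |ϕ γ - ϕ η| ≤ L * γ.1.1.supDist η.1.1
  growth_terminal : ∀ γ : TerminalPath d T, |ϕ γ| ≤ L * (1 + γ.1.1.supNorm)

/-- The Hamiltonian `H(γ_t, p) = inf_{u ∈ U} [(p, F(γ_t, u)) + q(γ_t, u)]`. -/
noncomputable def hamiltonian {U : Type*} (F : ContPath d T → U → EuclideanSpace ℝ (Fin d))
    (q : ContPath d T → U → ℝ) (γ : ContPath d T) (p : EuclideanSpace ℝ (Fin d)) : ℝ :=
  ⨅ u : U, (inner ℝ p (F γ u) + q γ u)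

/-- Viscosity `μ`-subsolutions of `∂ₜV + H(γ, ∂ₓV) = 0`, `V = ϕ` at time `T`. -/
def IsMuSubsolution {U : Type*} (F : ContPath d T → U → EuclideanSpace ℝ (Fin d))
    (q : ContPath d T → U → ℝ) (ϕ : TerminalPath d T → ℝ) (μ : ℝ) (w : ContPath d T → ℝ) : Prop :=
  (∀ γ : TerminalPath d T, w γ.1 ≤ ϕ γ) ∧
  ∀ M : ℝ, 0 < M → ∀ γ ∈ lipPaths d T μ 0 M, γ.1.time < T → ‖γ.1.toFun γ.1.time‖ < M →
    ∀ φ ∈ testAbove μ M γ w, ∀ φt φx, HasPathDerivsCont γ.1.time φ φt φx →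
      0 ≤ φt γ.1 + hamiltonian F q γ (φx γ.1)

/-- Viscosity `μ`-supersolutions of `∂ₜV + H(γ, ∂ₓV) = 0`, `V = ϕ` at time `T`. -/
def IsMuSupersolution {U : Type*} (F : ContPath d T → U → EuclideanSpace ℝ (Fin d))
    (q : ContPath d T → U → ℝ) (ϕ : TerminalPath d T → ℝ) (μ : ℝ) (w : ContPath d T → ℝ) : Prop :=
  (∀ γ : TerminalPath d T, ϕ γ ≤ w γ.1) ∧
  ∀ M : ℝ, 0 < M → ∀ γ ∈ lipPaths d T μ 0 M, γ.1.time < T → ‖γ.1.toFun γ.1.time‖ < M →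
    ∀ φ ∈ testBelow μ M γ w, ∀ φt φx, HasPathDerivsCont γ.1.time φ φt φx →
      -φt γ.1 + hamiltonian F q γ (-φx γ.1) ≤ 0

/-- Viscosity subsolutions: continuous, and `μ`-subsolutions for all large `μ`. -/
def IsViscositySubsolution {U : Type*} (F : ContPath d T → U → EuclideanSpace ℝ (Fin d))
    (q : ContPath d T → U → ℝ) (ϕ : TerminalPath d T → ℝ) (w : ContPath d T → ℝ) : Prop :=
  Continuous w ∧ ∃ μ₀ : ℝ, 0 < μ₀ ∧ ∀ μ : ℝ, μ₀ ≤ μ → IsMuSubsolution F q ϕ μ w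

/-- Viscosity supersolutions: continuous, and `μ`-supersolutions for all large `μ`. -/
def IsViscositySupersolution {U : Type*} (F : ContPath d T → U → EuclideanSpace ℝ (Fin d))
    (q : ContPath d T → U → ℝ) (ϕ : TerminalPath d T → ℝ) (w : ContPath d T → ℝ) : Prop :=
  Continuous w ∧ ∃ μ₀ : ℝ, 0 < μ₀ ∧ ∀ μ : ℝ, μ₀ ≤ μ → IsMuSupersolution F q ϕ μ w

/-- Linear growth: `|W(γ_t)| ≤ L (1 + ‖γ_t‖₀)`. -/
def LinearGrowth (L : ℝ) (W : ContPath d T → ℝ) : Prop :=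
  ∀ γ : ContPath d T, |W γ| ≤ L * (1 + γ.1.supNorm)

/-- The local Lipschitz bound
`|W(γ_t) - W(η_s)| ≤ L (1 + ‖γ_t‖₀ ∨ ‖η_s‖₀) d_∞(γ_t, η_s)`. -/
def LocallyLipschitzBound (L : ℝ) (W : ContPath d T → ℝ) : Prop :=
  ∀ γ η : ContPath d T,
    |W γ - W η| ≤ L * (1 + max γ.1.supNorm η.1.supNorm) * dist γ η

end PHJB

namespace PHJB

variable {d : ℕ} {T : ℝ}

/-! The path is doubled but the time is not: over pairs of Lipschitz paths `γ`, `η` with a common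
final time `t` one maximizes `W₁ γ - W₂ η - b² ∫₀ᵗ |η - γ|² - N b |η(t) - γ(t)|² - g(t, η(t))`.
Maximizers exist because bounded equi-Lipschitz paths form a compact set (`isCompact_lipPaths`), and
the penalty is `C¹` in the pathwise sense, so no smooth substitute for the uniform norm is needed.
For equi-Lipschitz paths the `L²` distance controls the uniform one; the weights are scaled so that
at a maximum `‖η - γ‖₀ = O(1/b)` and `b² |η(t) - γ(t)|² = O(1/N)` (`mul_supDist_le_of_penalty`,
`penalty_estimates`).

Since the two paths share their time, the maximum cannot be tested in each of them separately. The
subsolution property is therefore integrated beforehand: along the extension of `γ` with velocity `F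
γ u`, for a short time, `W₁` falls at rate at most `q γ u + ε` (`IsMuSubsolution.sub_le_extend`).
Inserting this extension for `γ` eliminates `W₁` and leaves a `C¹` functional of `η` alone that
tests `W₂` (`IsMuSupersolution.doubling_inequality`). For a control `u` nearly optimal in the
Hamiltonian at `η`, everything combines into an upper bound for the strictness parameter `ρ`
(`doubling_estimate`), which is absurd for large `N` and `b`.

The term `g` consists of `ρ (T - t)`, which gives strictness, and a cutoff that keeps the end points
inside the ball of radius `M`. The cutoff works for a time `1 / (8 L₀)` independent of `M`
(`le_of_le_later`), so finitely many steps backward from `T` suffice; in each one, density of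
Lipschitz paths gives all continuous paths. -/

theorem tendsto_const_add_nhdsGT (t : ℝ) : Tendsto (fun h : ℝ => t + h) (𝓝[>] 0) (𝓝[>] t) := by
  refine tendsto_nhdsWithin_iff.2 ⟨?_, ?_⟩
  · have : Tendsto (fun h : ℝ => t + h) (𝓝 0) (𝓝 (t + 0)) :=
      (continuous_const.add continuous_id).tendsto 0
    rw [add_zero] at this
    exact this.mono_left nhdsWithin_le_nhds
  · filter_upwards [self_mem_nhdsWithin] with u hu
    exact lt_add_of_pos_right _ (mem_Ioi.1 hu)

/-! ### Metric and measurability of càdlàg paths. -/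

namespace CadlagPath

theorem norm_le_supNorm (γ : CadlagPath d T) (s : ℝ) : ‖γ.toFun s‖ ≤ γ.supNorm := by
  obtain ⟨C, hC⟩ := γ.exists_bound
  exact le_ciSup (f := fun s => ‖γ.toFun s‖) ⟨C, by rintro _ ⟨s, rfl⟩; exact hC s⟩ s

theorem supNorm_nonneg (γ : CadlagPath d T) : 0 ≤ γ.supNorm :=
  (norm_nonneg _).trans (γ.norm_le_supNorm 0)

theorem supNorm_le {γ : CadlagPath d T} {C : ℝ} (h : ∀ s, ‖γ.toFun s‖ ≤ C) : γ.supNorm ≤ C :=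
  ciSup_le h

theorem supDist_le {γ η : CadlagPath d T} {C : ℝ} (h : ∀ s, ‖γ.toFun s - η.toFun s‖ ≤ C) :
    supDist γ η ≤ C :=
  ciSup_le h

theorem supDist_le_dist (γ η : CadlagPath d T) : supDist γ η ≤ dist γ η := by
  rw [dist_def]
  linarith [abs_nonneg (γ.time - η.time)]

theorem abs_time_sub_le_dist (γ η : CadlagPath d T) : |γ.time - η.time| ≤ dist γ η := by
  rw [dist_def]
  linarith [supDist_nonneg γ η]

theorem dist_eq_supDist {γ η : CadlagPath d T} (h : γ.time = η.time) :
    dist γ η = supDist γ η := by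
  rw [dist_def, h]
  simp

theorem norm_sub_le_dist (γ η : CadlagPath d T) (s : ℝ) :
    ‖γ.toFun s - η.toFun s‖ ≤ dist γ η :=
  (norm_sub_le_supDist γ η s).trans (supDist_le_dist γ η)

theorem continuous_time : Continuous (time : CadlagPath d T → ℝ) :=
  (LipschitzWith.of_dist_le_mul (K := 1) fun γ η => by
    simpa [Real.dist_eq] using abs_time_sub_le_dist γ η).continuous

theorem lipschitz_eval (s : ℝ) : LipschitzWith 1 (fun γ : CadlagPath d T => γ.toFun s) :=
  LipschitzWith.of_dist_le_mul fun γ η => by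
    simpa [dist_eq_norm] using norm_sub_le_dist γ η s

theorem toFun_time (γ : CadlagPath d T) : γ.toFun γ.time = γ.toFun T :=
  (γ.const_right T γ.time_mem.2).symm

theorem continuous_end : Continuous (fun γ : CadlagPath d T => γ.toFun γ.time) := by
  simp_rw [toFun_time]
  exact (lipschitz_eval T).continuous

/-- Right continuity makes the path the pointwise limit of its samples at the next grid point to the
right; each sample is a function of an integer part, hence measurable. -/
theorem measurable_toFun (γ : CadlagPath d T) : Measurable γ.toFun := by
  have h : ∀ n : ℕ, Measurable fun s : ℝ =>
      γ.toFun (((⌊((n : ℝ) + 1) * s⌋ : ℝ) + 1) / (n + 1)) := by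
    intro n
    have h1 : Measurable fun k : ℤ => γ.toFun (((k : ℝ) + 1) / ((n : ℝ) + 1)) :=
      measurable_from_top
    have h2 : Measurable fun s : ℝ => ⌊((n : ℝ) + 1) * s⌋ :=
      Int.measurable_floor.comp (measurable_const.mul measurable_id)
    exact h1.comp h2
  refine measurable_of_tendsto_metrizable h (tendsto_pi_nhds.2 fun s => ?_)
  refine (γ.right_cont s).tendsto.comp (tendsto_nhdsWithin_iff.2 ⟨?_, ?_⟩)
  · have h0 : Tendsto (fun n : ℕ => s + 1 / ((n : ℝ) + 1)) atTop (𝓝 s) := by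
      simpa using tendsto_const_nhds.add (tendsto_one_div_add_atTop_nhds_zero_nat (𝕜 := ℝ))
    refine tendsto_of_tendsto_of_tendsto_of_le_of_le tendsto_const_nhds h0 ?_ ?_
    · intro n
      have hn : (0 : ℝ) < (n : ℝ) + 1 := by positivity
      change s ≤ _
      rw [le_div_iff₀ hn]
      linarith [(Int.lt_floor_add_one (((n : ℝ) + 1) * s))]
    · intro n
      have hn : (0 : ℝ) < (n : ℝ) + 1 := by positivity
      change _ ≤ s + 1 / ((n : ℝ) + 1)
      have e : (s + 1 / ((n : ℝ) + 1)) * (n + 1) = ((n : ℝ) + 1) * s + 1 := by field_simp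
      rw [div_le_iff₀ hn, e]
      linarith [Int.floor_le (((n : ℝ) + 1) * s)]
  · refine Eventually.of_forall fun n => ?_
    have hn : (0 : ℝ) < (n : ℝ) + 1 := by positivity
    change s ≤ _
    rw [le_div_iff₀ hn]
    linarith [(Int.lt_floor_add_one (((n : ℝ) + 1) * s))]

/-! ### The squared `L²` distance as a `C¹` path functional. -/

/-- The squared `L²` distance over the lifetime of the first path. -/
noncomputable def sqDist (γ η : CadlagPath d T) : ℝ :=
  ∫ l in (0 : ℝ)..γ.time, ‖γ.toFun l - η.toFun l‖ ^ 2

theorem intervalIntegrable_sq (γ η : CadlagPath d T) (a b : ℝ) :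
    IntervalIntegrable (fun l => ‖γ.toFun l - η.toFun l‖ ^ 2) MeasureTheory.volume a b := by
  refine (intervalIntegrable_const (c := (supDist γ η) ^ 2)).mono_fun
    ((γ.measurable_toFun.sub η.measurable_toFun).norm.pow_const 2).aestronglyMeasurable
    (Eventually.of_forall fun l => ?_)
  change ‖‖γ.toFun l - η.toFun l‖ ^ 2‖ ≤ ‖(supDist γ η) ^ 2‖
  rw [Real.norm_of_nonneg (by positivity), Real.norm_of_nonneg (by positivity)]
  exact pow_le_pow_left₀ (norm_nonneg _) (norm_sub_le_supDist γ η l) 2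

theorem sqDist_nonneg (γ η : CadlagPath d T) : 0 ≤ sqDist γ η :=
  intervalIntegral.integral_nonneg γ.time_mem.1 fun _ _ => by positivity

theorem sqDist_self (γ : CadlagPath d T) : sqDist γ γ = 0 := by
  simp [sqDist]

/-- The change splits into a change of the integrand over the new lifetime, a difference of squares,
and a change of the upper limit of integration. -/
theorem abs_sqDist_sub_le (γ η γ' η' : CadlagPath d T) :
    |sqDist γ' η' - sqDist γ η| ≤
      (dist γ' γ + dist η' η) * (dist γ' γ + dist η' η + 2 * supDist γ η) * T
        + (supDist γ η) ^ 2 * dist γ' γ := by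
  have hT : 0 ≤ T := γ.time_mem.1.trans γ.time_mem.2
  have e : sqDist γ' η' - sqDist γ η =
      (∫ l in (0 : ℝ)..γ'.time, (‖γ'.toFun l - η'.toFun l‖ ^ 2 - ‖γ.toFun l - η.toFun l‖ ^ 2))
        + ∫ l in γ.time..γ'.time, ‖γ.toFun l - η.toFun l‖ ^ 2 := by
    rw [intervalIntegral.integral_sub (intervalIntegrable_sq _ _ _ _)
      (intervalIntegrable_sq _ _ _ _), ← intervalIntegral.integral_interval_sub_left
      (intervalIntegrable_sq γ η 0 γ'.time) (intervalIntegrable_sq γ η 0 γ.time)]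
    simp only [sqDist]
    ring
  rw [e]
  refine (abs_add_le _ _).trans (add_le_add ?_ ?_)
  · set r := dist γ' γ + dist η' η with hr
    have hr0 : 0 ≤ r := by positivity
    have h1 := intervalIntegral.norm_integral_le_of_norm_le_const (a := 0) (b := γ'.time)
      (f := fun l => ‖γ'.toFun l - η'.toFun l‖ ^ 2 - ‖γ.toFun l - η.toFun l‖ ^ 2)
      (C := r * (r + 2 * supDist γ η)) ?_
    · refine h1.trans ?_
      rw [sub_zero, abs_of_nonneg γ'.time_mem.1]
      exact mul_le_mul_of_nonneg_left γ'.time_mem.2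
        (mul_nonneg hr0 (by linarith [supDist_nonneg γ η]))
    · intro l _
      have h2 : |‖γ'.toFun l - η'.toFun l‖ - ‖γ.toFun l - η.toFun l‖| ≤ r := by
        refine (abs_norm_sub_norm_le _ _).trans ?_
        have : γ'.toFun l - η'.toFun l - (γ.toFun l - η.toFun l)
          = (γ'.toFun l - γ.toFun l) - (η'.toFun l - η.toFun l) := by abel
        rw [this]
        exact (norm_sub_le _ _).trans
          (add_le_add (norm_sub_le_dist _ _ _) (norm_sub_le_dist _ _ _))
      have h3 := norm_sub_le_supDist γ η l
      rw [sq_sub_sq, norm_mul, mul_comm]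
      refine mul_le_mul h2 ?_ (norm_nonneg _) hr0
      rw [Real.norm_of_nonneg (by positivity)]
      have := (abs_le.1 h2).2
      linarith
  · have h1 := intervalIntegral.norm_integral_le_of_norm_le_const (a := γ.time) (b := γ'.time)
      (f := fun l => ‖γ.toFun l - η.toFun l‖ ^ 2) (C := (supDist γ η) ^ 2) ?_
    · exact h1.trans (mul_le_mul_of_nonneg_left (abs_time_sub_le_dist γ' γ) (by positivity))
    · intro l _
      rw [Real.norm_of_nonneg (by positivity)]
      exact pow_le_pow_left₀ (norm_nonneg _) (norm_sub_le_supDist γ η l) 2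

theorem continuous_sqDist :
    Continuous fun p : CadlagPath d T × CadlagPath d T => sqDist p.1 p.2 := by
  refine continuous_iff_continuousAt.2 fun p => ?_
  rw [ContinuousAt, tendsto_iff_norm_sub_tendsto_zero]
  have h1 : Tendsto (fun x : CadlagPath d T × CadlagPath d T => dist x.1 p.1) (𝓝 p) (𝓝 0) := by
    have : Continuous (fun x : CadlagPath d T × CadlagPath d T => dist x.1 p.1) := by fun_prop
    simpa using this.tendsto p
  have h2 : Tendsto (fun x : CadlagPath d T × CadlagPath d T => dist x.2 p.2) (𝓝 p) (𝓝 0) := by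
    have : Continuous (fun x : CadlagPath d T × CadlagPath d T => dist x.2 p.2) := by fun_prop
    simpa using this.tendsto p
  refine squeeze_zero (fun _ => norm_nonneg _) (fun x => abs_sqDist_sub_le p.1 p.2 x.1 x.2) ?_
  have h3 := h1.add h2
  simpa using ((h3.mul (h3.add_const (2 * supDist p.1 p.2))).mul_const T).add
    (h1.const_mul (supDist p.1 p.2 ^ 2))

/-- A bump is invisible to the integral, so this part of the penalty has no vertical derivative. -/
theorem sqDist_bump (γ η : CadlagPath d T) (x : EuclideanSpace ℝ (Fin d)) :
    sqDist (γ.bump x) η = sqDist γ η := by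
  refine intervalIntegral.integral_congr_Ioo_of_le γ.time_mem.1 fun l hl => ?_
  have : ¬ γ.time ≤ max l 0 := by
    rw [max_eq_left hl.1.le]
    exact not_le.2 hl.2
  simp only [bump, if_neg this, add_zero]

/-- Freezing moves only the upper limit of the integral; right continuity of the integrand gives the
one-sided derivative. -/
theorem sqDist_freeze_tendsto (γ η : CadlagPath d T) (h : γ.time < T) :
    Tendsto (fun h : ℝ => h⁻¹ * (sqDist (γ.freeze (γ.time + h)) η - sqDist γ η)) (𝓝[>] 0)
      (𝓝 (‖γ.toFun γ.time - η.toFun γ.time‖ ^ 2)) := by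
  have h1 : HasDerivWithinAt (fun u => ∫ l in (0 : ℝ)..u, ‖γ.toFun l - η.toFun l‖ ^ 2)
      (‖γ.toFun γ.time - η.toFun γ.time‖ ^ 2) (Ici γ.time) γ.time :=
    intervalIntegral.integral_hasDerivWithinAt_right (t := Ioi γ.time)
      (intervalIntegrable_sq γ η 0 γ.time)
      ((γ.measurable_toFun.sub η.measurable_toFun).norm.pow_const
        2).stronglyMeasurable.stronglyMeasurableAtFilter
      (((((γ.right_cont _).sub (η.right_cont _)).norm).pow 2).mono Ioi_subset_Ici_self)
  have h2 := (hasDerivWithinAt_iff_tendsto_slope' (self_notMem_Ioi)).1 h1.Ioi_of_Ici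
  have h3 := tendsto_const_add_nhdsGT γ.time
  refine (h2.comp h3).congr' ?_
  have h4 : Iio (T - γ.time) ∈ 𝓝[>] (0 : ℝ) :=
    mem_nhdsWithin_of_mem_nhds (Iio_mem_nhds (by linarith))
  filter_upwards [self_mem_nhdsWithin, h4] with u hu hu'
  have e : max γ.time (min (γ.time + u) T) = γ.time + u := by
    rw [min_eq_left (by linarith [mem_Iio.1 hu']), max_eq_right (by linarith [mem_Ioi.1 hu])]
  simp [slope, sqDist, freeze, e]

/-- The left limit of a path at the terminal time `T`; for paths that end before `T` this is the
final value. -/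
noncomputable def endLeft (γ : CadlagPath d T) : EuclideanSpace ℝ (Fin d) := (γ.left_lim T).choose

theorem tendsto_endLeft (γ : CadlagPath d T) : Tendsto γ.toFun (𝓝[<] T) (𝓝 γ.endLeft) :=
  (γ.left_lim T).choose_spec

theorem endLeft_eq {γ : CadlagPath d T} (h : γ.time < T) : γ.endLeft = γ.toFun γ.time := by
  refine tendsto_nhds_unique γ.tendsto_endLeft (tendsto_const_nhds.congr' ?_)
  filter_upwards [mem_nhdsWithin_of_mem_nhds (Ioi_mem_nhds h)] with u hu
  exact (γ.const_right u (mem_Ioi.1 hu).le).symm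

theorem continuous_endLeft : Continuous (endLeft : CadlagPath d T → _) := by
  refine (LipschitzWith.of_dist_le_mul (K := 1) fun γ η => ?_).continuous
  rw [dist_eq_norm, NNReal.coe_one, one_mul]
  exact le_of_tendsto (γ.tendsto_endLeft.sub η.tendsto_endLeft).norm
    (Eventually.of_forall fun s => norm_sub_le_dist γ η s)

/-- At time `T` the horizontal derivative is a limit along restrictions, which see the left limit
and not the value after a possible jump. This is why horizontal derivatives are expressed through
`endLeft`. -/
theorem tendsto_endLeft_restrict (γ : CadlagPath d T) (h : γ.time = T) (hT : 0 < T) :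
    Tendsto (fun s => ((γ.restrict s).time, (γ.restrict s).endLeft)) (𝓝[<] T)
      (𝓝 (T, γ.endLeft)) := by
  have h1 : Tendsto (fun s => (s, γ.toFun s)) (𝓝[<] T) (𝓝 (T, γ.endLeft)) := by
    rw [nhds_prod_eq]
    exact (tendsto_nhdsWithin_of_tendsto_nhds tendsto_id).prodMk γ.tendsto_endLeft
  refine h1.congr' ?_
  filter_upwards [self_mem_nhdsWithin, mem_nhdsWithin_of_mem_nhds (Ioi_mem_nhds hT)] with s hs hs'
  have e : max 0 (min s γ.time) = s := by
    rw [h, min_eq_left (mem_Iio.1 hs).le, max_eq_right (mem_Ioi.1 hs').le]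
  have e1 : (γ.restrict s).time = s := e
  rw [endLeft_eq (by rw [e1]; exact hs), e1]
  simp [restrict, e]

end CadlagPath

open CadlagPath in
/-- Pathwise derivatives of `γ_t ↦ b ∫₀ᵗ |γ(l) - X(l)|² dl + g(t, γ(t))`. -/
theorem hasPathDerivs_sqDist_add (hT : 0 < T) (X : ContPath d T) (b t : ℝ)
    {g gt : ℝ → EuclideanSpace ℝ (Fin d) → ℝ}
    {gx : ℝ → EuclideanSpace ℝ (Fin d) → EuclideanSpace ℝ (Fin d)}
    (hg : Continuous fun p : ℝ × EuclideanSpace ℝ (Fin d) => g p.1 p.2)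
    (hgt : Continuous fun p : ℝ × EuclideanSpace ℝ (Fin d) => gt p.1 p.2)
    (hgx : Continuous fun p : ℝ × EuclideanSpace ℝ (Fin d) => gx p.1 p.2)
    (ht : ∀ s x, HasDerivAt (fun r => g r x) (gt s x) s)
    (hx : ∀ s x, HasGradientAt (g s) (gx s x) x) :
    HasPathDerivs t (fun γ : CadlagPath d T => b * sqDist γ X.1 + g γ.time (γ.toFun γ.time))
      (fun γ => b * ‖γ.endLeft - X.1.toFun γ.time‖ ^ 2 + gt γ.time γ.endLeft)
      (fun γ => gx γ.time (γ.toFun γ.time)) := by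
  have hX : Continuous X.1.toFun := X.2
  have hE : Continuous fun p : ℝ × EuclideanSpace ℝ (Fin d) =>
      b * ‖p.2 - X.1.toFun p.1‖ ^ 2 + gt p.1 p.2 := by fun_prop
  refine ⟨?_, ?_, ?_, ?_, ?_, ?_⟩
  · have h1 : Continuous fun γ : CadlagPath d T => sqDist γ X.1 :=
      Continuous.comp (f := fun γ : CadlagPath d T => (γ, X.1)) continuous_sqDist
        (continuous_id.prodMk continuous_const)
    have h2 : Continuous fun γ : CadlagPath d T => g γ.time (γ.toFun γ.time) :=
      Continuous.comp (f := fun γ : CadlagPath d T => (γ.time, γ.toFun γ.time)) hg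
        (continuous_time.prodMk continuous_end)
    exact ((continuous_const.mul h1).add h2).continuousOn
  · have h1 : Continuous fun γ : CadlagPath d T => (γ.time, γ.endLeft) :=
      continuous_time.prodMk continuous_endLeft
    exact (Continuous.comp (f := fun γ : CadlagPath d T => (γ.time, γ.endLeft))
      hE h1).continuousOn
  · have h1 : Continuous fun γ : CadlagPath d T => (γ.time, γ.toFun γ.time) :=
      continuous_time.prodMk continuous_end
    exact (Continuous.comp (f := fun γ : CadlagPath d T => (γ.time, γ.toFun γ.time))
      hgx h1).continuousOn
  · intro γ _ hγ
    have h1 := (sqDist_freeze_tendsto γ X.1 hγ).const_mul b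
    have h2 := (hasDerivWithinAt_iff_tendsto_slope' (self_notMem_Ioi)).1
      ((ht γ.time (γ.toFun γ.time)).hasDerivWithinAt (s := Ioi γ.time))
    have h3 := tendsto_const_add_nhdsGT γ.time
    rw [endLeft_eq hγ]
    refine (h1.add (h2.comp h3)).congr' ?_
    have h4 : Iio (T - γ.time) ∈ 𝓝[>] (0 : ℝ) :=
      mem_nhdsWithin_of_mem_nhds (Iio_mem_nhds (by linarith))
    filter_upwards [self_mem_nhdsWithin, h4] with u hu hu'
    have e : (γ.freeze (γ.time + u)).time = γ.time + u := by
      change max γ.time (min (γ.time + u) T) = γ.time + u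
      rw [min_eq_left (by linarith [mem_Iio.1 hu']), max_eq_right (by linarith [mem_Ioi.1 hu])]
    have e2 : (γ.freeze (γ.time + u)).toFun (γ.freeze (γ.time + u)).time = γ.toFun γ.time := by
      rw [e]
      exact γ.const_right _ (by linarith [mem_Ioi.1 hu])
    rw [e2, e]
    simp only [Function.comp, slope, vsub_eq_sub, smul_eq_mul]
    rw [add_sub_cancel_left]
    ring
  · intro γ _ hγ
    have := (hE.tendsto (T, γ.endLeft)).comp (tendsto_endLeft_restrict γ hγ hT)
    rw [hγ]
    exact this
  · intro γ _ i
    have h1 := (hx γ.time (γ.toFun γ.time)).hasFDerivAt.hasLineDerivAt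
      (EuclideanSpace.single i (1 : ℝ))
    have h2 := h1.tendsto_slope_zero
    have e3 : ((InnerProductSpace.toDual ℝ _) (gx γ.time (γ.toFun γ.time)))
        (EuclideanSpace.single i (1 : ℝ)) = gx γ.time (γ.toFun γ.time) i := by
      simp [InnerProductSpace.toDual_apply_apply, EuclideanSpace.inner_single_right]
    rw [e3] at h2
    refine h2.congr fun u => ?_
    have e : (γ.bump (u • EuclideanSpace.single i (1 : ℝ))).toFun γ.time =
        γ.toFun γ.time + u • EuclideanSpace.single i (1 : ℝ) := by
      simp [bump]
    have e' : (γ.bump (u • EuclideanSpace.single i (1 : ℝ))).time = γ.time := rfl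
    rw [sqDist_bump, e', e, smul_eq_mul]
    ring

/-! ### Lipschitz paths: compactness, density, and control of the uniform distance by the penalty.
-/

theorem abs_clamp_sub_le (t l r : ℝ) : |max 0 (min l t) - max 0 (min r t)| ≤ |l - r| :=
  (abs_max_sub_max_le_max 0 _ 0 _).trans (by
    simpa using abs_min_sub_min_le_max l t r t)

/-- The path with final time `t` that follows a continuous function on `[0, t]`. -/
noncomputable def clampPath (t : ℝ) (ht : t ∈ Icc (0 : ℝ) T) (f : ℝ → EuclideanSpace ℝ (Fin d))
    (hf : Continuous f) : ContPath d T where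
  val :=
    { time := t
      toFun := fun s => f (max 0 (min s t))
      time_mem := ht
      const_left := fun s hs => by
        rw [min_eq_left (hs.trans ht.1), max_eq_left hs, min_eq_left ht.1, max_self]
      const_right := fun s hs => by rw [min_eq_right hs, min_self]
      right_cont := fun s => (hf.comp (by fun_prop)).continuousWithinAt
      left_lim := fun s => ⟨f (max 0 (min s t)),
        ((hf.comp (by fun_prop : Continuous fun s => max 0 (min s t))).tendsto s).mono_left
          nhdsWithin_le_nhds⟩ }
  property := hf.comp (by fun_prop)

theorem clampPath_apply {t : ℝ} {ht : t ∈ Icc (0 : ℝ) T} {f : ℝ → EuclideanSpace ℝ (Fin d)}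
    {hf : Continuous f} (s : ℝ) :
    (clampPath t ht f hf).1.toFun s = f (max 0 (min s t)) := rfl

theorem lipPaths_anti {μ M s t : ℝ} (h : s ≤ t) : lipPaths d T μ t M ⊆ lipPaths d T μ s M :=
  fun _ hγ => ⟨h.trans hγ.1, hγ.2⟩

theorem norm_le_of_mem_lipPaths {μ M t : ℝ} {γ : ContPath d T} (h : γ ∈ lipPaths d T μ t M)
    (s : ℝ) : ‖γ.1.toFun s‖ ≤ M :=
  (γ.1.norm_le_supNorm s).trans h.2.1

theorem norm_sub_le_of_mem_lipPaths {μ M t : ℝ} (hK : 0 ≤ μ * (1 + M)) {γ : ContPath d T}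
    (h : γ ∈ lipPaths d T μ t M) (l r : ℝ) :
    ‖γ.1.toFun l - γ.1.toFun r‖ ≤ μ * (1 + M) * |l - r| := by
  rw [γ.1.toFun_clamp l, γ.1.toFun_clamp r]
  have h1 := γ.1.time_mem.1
  refine le_trans ?_ (mul_le_mul_of_nonneg_left (abs_clamp_sub_le γ.1.time l r) hK)
  have key : ∀ x y : ℝ, 0 ≤ x → x < y → y ≤ γ.1.time →
      ‖γ.1.toFun x - γ.1.toFun y‖ ≤ μ * (1 + M) * |x - y| := by
    intro x y hx hxy hy
    have := h.2.2 x y hx hxy hy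
    rwa [div_le_iff₀ (abs_pos.2 (sub_ne_zero.2 hxy.ne))] at this
  have hb : ∀ x : ℝ, 0 ≤ max 0 (min x γ.1.time) ∧ max 0 (min x γ.1.time) ≤ γ.1.time :=
    fun x => ⟨le_max_left _ _, max_le h1 (min_le_right _ _)⟩
  rcases lt_trichotomy (max 0 (min l γ.1.time)) (max 0 (min r γ.1.time)) with h2 | h2 | h2
  · exact key _ _ (hb l).1 h2 (hb r).2
  · simp [h2]
  · rw [norm_sub_rev, abs_sub_comm]
    exact key _ _ (hb r).1 h2 (hb l).2

theorem mem_lipPaths {μ M t : ℝ} {γ : ContPath d T} (ht : t ≤ γ.1.time)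
    (hM : ∀ s, ‖γ.1.toFun s‖ ≤ M)
    (h : ∀ l r : ℝ, ‖γ.1.toFun l - γ.1.toFun r‖ ≤ μ * (1 + M) * |l - r|) :
    γ ∈ lipPaths d T μ t M := by
  refine ⟨ht, CadlagPath.supNorm_le hM, fun l r _ hlr _ => ?_⟩
  rw [div_le_iff₀ (abs_pos.2 (sub_ne_zero.2 hlr.ne))]
  exact h l r

theorem continuous_contPath_time : Continuous fun γ : ContPath d T => γ.1.time :=
  CadlagPath.continuous_time.comp continuous_subtype_val

theorem continuous_contPath_apply (s : ℝ) : Continuous fun γ : ContPath d T => γ.1.toFun s :=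
  (CadlagPath.lipschitz_eval s).continuous.comp continuous_subtype_val

theorem isClosed_lipPaths {μ M t : ℝ} (hK : 0 ≤ μ * (1 + M)) :
    IsClosed (lipPaths d T μ t M) := by
  have e : lipPaths d T μ t M = {γ | t ≤ γ.1.time} ∩ ((⋂ s, {γ | ‖γ.1.toFun s‖ ≤ M}) ∩
      ⋂ l, ⋂ r, {γ | ‖γ.1.toFun l - γ.1.toFun r‖ ≤ μ * (1 + M) * |l - r|}) := by
    ext γ
    simp only [mem_inter_iff, mem_iInter, mem_ofPred_eq]
    exact ⟨fun h => ⟨h.1, norm_le_of_mem_lipPaths h, norm_sub_le_of_mem_lipPaths hK h⟩,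
      fun h => mem_lipPaths h.1 h.2.1 h.2.2⟩
  rw [e]
  refine (isClosed_le continuous_const continuous_contPath_time).inter
    ((isClosed_iInter fun s => isClosed_le (continuous_contPath_apply s).norm
      continuous_const).inter (isClosed_iInter fun l => isClosed_iInter fun r =>
      isClosed_le ((continuous_contPath_apply l).sub (continuous_contPath_apply r)).norm
        continuous_const))

/-- The sets of uniformly bounded, uniformly Lipschitz paths are compact. -/
theorem isCompact_lipPaths (hT : 0 < T) {μ M t : ℝ} (hK : 0 ≤ μ * (1 + M)) :
    IsCompact (lipPaths d T μ t M) := by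
  set K := μ * (1 + M) with hKdef
  -- Arzelà–Ascoli is applied to functions on all of `[0, T]`. Stopping such a function at a chosen
  -- final time is the map `Φ`, Lipschitz on these pairs, and its image contains the closed set in
  -- question.
  set A : Set (BoundedContinuousFunction (Icc (0 : ℝ) T) (EuclideanSpace ℝ (Fin d))) :=
    {f | (∀ x, f x ∈ Metric.closedBall 0 M) ∧ ∀ x y, dist (f x) (f y) ≤ K * dist x y} with hA
  have hAc : IsCompact A := by
    refine BoundedContinuousFunction.arzela_ascoli₂ (Metric.closedBall 0 M)
      (isCompact_closedBall _ _) A ?_ (fun f x hf => hf.1 x) ?_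
    · have e : A = (⋂ x, {f | f x ∈ Metric.closedBall 0 M}) ∩
          ⋂ x, ⋂ y, {f | dist (f x) (f y) ≤ K * dist x y} := by
        ext f
        simp only [hA, mem_inter_iff, mem_iInter, mem_ofPred_eq]
      rw [e]
      refine (isClosed_iInter fun x => Metric.isClosed_closedBall.preimage ?_).inter
        (isClosed_iInter fun x => isClosed_iInter fun y => isClosed_le ?_ continuous_const)
      · exact continuous_eval_const x
      · exact (continuous_eval_const x).dist
          (continuous_eval_const y)
    · refine Metric.equicontinuous_of_continuity_modulus (fun r => K * r) ?_ _ ?_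
      · have : Continuous fun r : ℝ => K * r := by fun_prop
        simpa using this.tendsto 0
      · exact fun x y f => f.2.2 x y
  let Φ : Icc (0 : ℝ) T × BoundedContinuousFunction (Icc (0 : ℝ) T) (EuclideanSpace ℝ (Fin d)) →
      ContPath d T := fun p => clampPath p.1.1 p.1.2 (fun s => p.2 (projIcc 0 T hT.le s))
        (p.2.continuous.comp continuous_projIcc)
  have hproj : ∀ s s' : ℝ, dist (projIcc 0 T hT.le s) (projIcc 0 T hT.le s') ≤ dist s s' := by
    intro s s'
    have := (LipschitzWith.projIcc hT.le).dist_le_mul s s'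
    simpa using this
  have hclamp : ∀ s t t' : ℝ, |max 0 (min s t) - max 0 (min s t')| ≤ |t - t'| := by
    intro s t t'
    refine (abs_max_sub_max_le_max 0 _ 0 _).trans ?_
    simpa using abs_min_sub_min_le_max s t s t'
  have hΦ : ContinuousOn Φ ((univ : Set (Icc (0 : ℝ) T)) ×ˢ A) := by
    refine (LipschitzOnWith.of_dist_le_mul (K := ⟨2 + K, by linarith⟩) ?_).continuousOn
    rintro ⟨x, f⟩ ⟨_, hf⟩ ⟨y, g⟩ ⟨_, hg⟩
    change |x.1 - y.1| + CadlagPath.supDist (Φ (x, f)).1 (Φ (y, g)).1 ≤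
      (2 + K) * dist (x, f) (y, g)
    have h1 : dist x y ≤ dist (x, f) (y, g) := le_max_left _ _
    have h2 : dist f g ≤ dist (x, f) (y, g) := le_max_right _ _
    have h3 : CadlagPath.supDist (Φ (x, f)).1 (Φ (y, g)).1 ≤ K * dist x y + dist f g := by
      refine CadlagPath.supDist_le fun s => ?_
      change ‖f (projIcc 0 T hT.le (max 0 (min s x.1))) -
        g (projIcc 0 T hT.le (max 0 (min s y.1)))‖ ≤ _
      rw [← dist_eq_norm]
      refine (dist_triangle _ (f (projIcc 0 T hT.le (max 0 (min s y.1)))) _).trans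
        (add_le_add ((hf.2 _ _).trans (mul_le_mul_of_nonneg_left ?_ hK))
          (BoundedContinuousFunction.dist_coe_le_dist _))
      refine (hproj _ _).trans ?_
      rw [Real.dist_eq]
      exact hclamp s x.1 y.1
    have h4 : |x.1 - y.1| = dist x y := rfl
    have h5 := mul_le_mul_of_nonneg_left h1 hK
    rw [h4]
    nlinarith
  refine IsCompact.of_isClosed_subset ((isCompact_univ.prod hAc).image_of_continuousOn hΦ)
    (isClosed_lipPaths hK) fun γ hγ => ?_
  have hγn := norm_le_of_mem_lipPaths hγ
  have hγl := norm_sub_le_of_mem_lipPaths hK hγ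
  refine ⟨(⟨γ.1.time, γ.1.time_mem⟩, BoundedContinuousFunction.mkOfCompact
    ⟨fun x => γ.1.toFun x.1, γ.2.comp continuous_subtype_val⟩), ⟨mem_univ _, ?_, ?_⟩, ?_⟩
  · intro x
    simpa using hγn x.1
  · intro x y
    rw [dist_eq_norm]
    exact hγl x.1 y.1
  · refine Subtype.ext (CadlagPath.ext rfl (funext fun s => ?_))
    have hm : max 0 (min s γ.1.time) ∈ Icc (0 : ℝ) T :=
      ⟨le_max_left _ _, max_le hT.le ((min_le_right _ _).trans γ.1.time_mem.2)⟩
    change γ.1.toFun (projIcc 0 T hT.le (max 0 (min s γ.1.time))).1 = γ.1.toFun s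
    rw [projIcc_of_mem _ hm, ← γ.1.toFun_clamp]

/-- For uniformly Lipschitz differences, a bound of the quadratic penalty by the uniform distance
is a bound of the uniform distance. -/
theorem mul_supDist_le_of_penalty {γ η : ContPath d T} (ht : γ.1.time = η.1.time) {Λ b N C : ℝ}
    (hΛ : 0 < Λ)
    (hD : ∀ l r : ℝ, ‖(γ.1.toFun l - η.1.toFun l) - (γ.1.toFun r - η.1.toFun r)‖ ≤ Λ * |l - r|)
    (hb : 0 < b) (hN : 1 ≤ N) (hC : 0 ≤ C)
    (h : b ^ 2 * γ.1.sqDist η.1 + N * b * ‖γ.1.toFun γ.1.time - η.1.toFun γ.1.time‖ ^ 2 ≤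
      C * γ.1.supDist η.1) :
    b * γ.1.supDist η.1 ≤ 16 * Λ * C + 4 * C + 1 := by
  set y := γ.1.supDist η.1 with hy
  rcases (γ.1.supDist_nonneg η.1).eq_or_lt with h0 | h0
  · rw [hy, ← h0, mul_zero]
    positivity
  have hJ := γ.1.sqDist_nonneg η.1
  -- Either the final gap is at least `y / 2` and the end term alone gives the bound, or a gap above
  -- `3 y / 4` occurs earlier and the integral gives it.
  by_cases hc : y / 2 ≤ ‖γ.1.toFun γ.1.time - η.1.toFun γ.1.time‖
  · have h1 : (y / 2) ^ 2 ≤ ‖γ.1.toFun γ.1.time - η.1.toFun γ.1.time‖ ^ 2 :=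
      pow_le_pow_left₀ (by positivity) hc 2
    have h2 : b * (y / 2) ^ 2 ≤ N * b * ‖γ.1.toFun γ.1.time - η.1.toFun γ.1.time‖ ^ 2 :=
      mul_le_mul (by nlinarith) h1 (by positivity) (by positivity)
    have h3 : b * (y / 2) ^ 2 ≤ C * y := by
      have : 0 ≤ b ^ 2 * γ.1.sqDist η.1 := by positivity
      linarith
    have h4 : b * y ≤ 4 * C := by
      refine le_of_mul_le_mul_right ?_ h0
      nlinarith
    have : 0 ≤ 16 * Λ * C := by positivity
    linarith
  · push Not at hc
    obtain ⟨l, hl⟩ : ∃ l, 3 / 4 * y < ‖γ.1.toFun l - η.1.toFun l‖ :=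
      exists_lt_of_lt_ciSup (by change 3 / 4 * y < y; linarith)
    rw [γ.1.toFun_clamp, η.1.toFun_clamp, ← ht] at hl
    set k := max 0 (min l γ.1.time) with hk
    have hk0 : 0 ≤ k := le_max_left _ _
    have hkt : k ≤ γ.1.time := max_le γ.1.time_mem.1 (min_le_right _ _)
    have hDk : ∀ s, k ≤ s → ‖γ.1.toFun k - η.1.toFun k‖ - Λ * (s - k) ≤
        ‖γ.1.toFun s - η.1.toFun s‖ := by
      intro s hs
      have h1 := hD k s
      have h2 := norm_sub_norm_le (γ.1.toFun k - η.1.toFun k) (γ.1.toFun s - η.1.toFun s)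
      rw [abs_sub_comm, abs_of_nonneg (by linarith)] at h1
      linarith
    -- Over a window of length `w` the gap loses at most `Λ w = y / 4`, so it stays above `y / 2`;
    -- the window ends before the final time because the final gap is smaller. The integral is thus
    -- at least `y³ / (16 Λ)`, whence `(b y)² ≤ 16 Λ C`.
    set w := y / (4 * Λ) with hw
    have hw0 : 0 < w := by positivity
    have hwΛ : Λ * w = y / 4 := by rw [hw]; field_simp
    have hkw : k + w ≤ γ.1.time := by
      have h1 := hDk _ hkt
      by_contra h2
      push Not at h2
      have : Λ * (γ.1.time - k) ≤ Λ * w := mul_le_mul_of_nonneg_left (by linarith) hΛ.le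
      linarith
    have hint : w * (y / 2) ^ 2 ≤ γ.1.sqDist η.1 := by
      have h1 : ∫ _ in k..(k + w), (y / 2) ^ 2 ≤
          ∫ s in k..(k + w), ‖γ.1.toFun s - η.1.toFun s‖ ^ 2 := by
        refine intervalIntegral.integral_mono_on (by linarith) intervalIntegrable_const
          (CadlagPath.intervalIntegrable_sq _ _ _ _) fun s hs => ?_
        have h2 := hDk s hs.1
        have h3 : Λ * (s - k) ≤ Λ * w := mul_le_mul_of_nonneg_left (by linarith [hs.2]) hΛ.le
        exact pow_le_pow_left₀ (by positivity) (by linarith) 2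
      rw [intervalIntegral.integral_const, add_sub_cancel_left, smul_eq_mul] at h1
      refine h1.trans ?_
      exact intervalIntegral.integral_mono_interval hk0 (by linarith) hkw
        (Eventually.of_forall fun s => by positivity) (CadlagPath.intervalIntegrable_sq _ _ _ _)
    have h3 : b ^ 2 * (w * (y / 2) ^ 2) ≤ C * y := by
      have h4 := mul_le_mul_of_nonneg_left hint (sq_nonneg b)
      have : 0 ≤ N * b * ‖γ.1.toFun γ.1.time - η.1.toFun γ.1.time‖ ^ 2 := by positivity
      linarith
    have h5 : (b * y) ^ 2 ≤ 16 * Λ * C := by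
      refine le_of_mul_le_mul_right ?_ h0
      have e : (b * y) ^ 2 * y = 16 * Λ * (b ^ 2 * (w * (y / 2) ^ 2)) := by
        rw [hw]; field_simp; ring
      rw [e]
      nlinarith [mul_le_mul_of_nonneg_left h3 (by positivity : 0 ≤ 16 * Λ)]
    have h6 : 0 ≤ 16 * Λ * C := by positivity
    nlinarith [sq_nonneg (b * y - 1)]

open MeasureTheory in
/-- Lipschitz paths are dense among continuous paths with a given final time. -/
theorem exists_lipschitz_approx (γ : ContPath d T) {ε : ℝ} (hε : 0 < ε) :
    ∃ η : ContPath d T, η.1.time = γ.1.time ∧ dist η γ ≤ ε ∧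
      ∃ K, 0 ≤ K ∧ ∀ l r : ℝ, ‖η.1.toFun l - η.1.toFun r‖ ≤ K * |l - r| := by
  obtain ⟨B, hB⟩ := γ.1.exists_bound
  have hB0 : 0 ≤ B := (norm_nonneg _).trans (hB 0)
  have hc : Continuous γ.1.toFun := γ.2
  have hu := isCompact_Icc.uniformContinuousOn_of_continuous
    (hc.continuousOn (s := Icc (0 : ℝ) γ.1.time))
  obtain ⟨r, hr, hru⟩ := Metric.uniformContinuousOn_iff.1 hu ε hε
  have hcl : ∀ s, max 0 (min s γ.1.time) ∈ Icc (0 : ℝ) γ.1.time := fun s =>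
    ⟨le_max_left _ _, max_le γ.1.time_mem.1 (min_le_right _ _)⟩
  have hmod : ∀ s l : ℝ, |s - l| < r → ‖γ.1.toFun s - γ.1.toFun l‖ < ε := by
    intro s l hsl
    rw [γ.1.toFun_clamp s, γ.1.toFun_clamp l, ← dist_eq_norm]
    exact hru _ (hcl s) _ (hcl l) ((abs_clamp_sub_le _ _ _).trans_lt hsl)
  have hr2 : 0 < r / 2 := by positivity
  have hii : ∀ a b : ℝ, IntervalIntegrable γ.1.toFun volume a b := fun a b =>
    hc.intervalIntegrable a b
  -- A forward moving average: Lipschitz because the path is bounded, uniformly close to it by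
  -- uniform continuity.
  let g : ℝ → EuclideanSpace ℝ (Fin d) := fun s => (r / 2)⁻¹ • ∫ l in s..(s + r / 2), γ.1.toFun l
  have hlip : ∀ x y : ℝ, ‖g x - g y‖ ≤ (r / 2)⁻¹ * (2 * B) * |x - y| := by
    intro x y
    have e : (∫ l in x..(x + r / 2), γ.1.toFun l) - (∫ l in y..(y + r / 2), γ.1.toFun l) =
        (∫ l in x..y, γ.1.toFun l) - ∫ l in (x + r / 2)..(y + r / 2), γ.1.toFun l :=
      intervalIntegral.integral_interval_sub_interval_comm (hii _ _) (hii _ _) (hii _ _)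
    have h1 := intervalIntegral.norm_integral_le_of_norm_le_const (a := x) (b := y)
      (f := γ.1.toFun) (C := B) (fun l _ => hB l)
    have h2 := intervalIntegral.norm_integral_le_of_norm_le_const (a := x + r / 2)
      (b := y + r / 2) (f := γ.1.toFun) (C := B) (fun l _ => hB l)
    rw [add_sub_add_right_eq_sub] at h2
    change ‖(r / 2)⁻¹ • _ - (r / 2)⁻¹ • _‖ ≤ _
    rw [← smul_sub, e, norm_smul, Real.norm_of_nonneg (by positivity), mul_assoc]
    refine mul_le_mul_of_nonneg_left ((norm_sub_le _ _).trans ?_) (by positivity)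
    rw [abs_sub_comm x y]
    linarith
  have hK : 0 ≤ (r / 2)⁻¹ * (2 * B) := by positivity
  have hgc : Continuous g :=
    (LipschitzWith.of_dist_le_mul (K := ⟨_, hK⟩) fun x y => by
      rw [dist_eq_norm, Real.dist_eq]; exact hlip x y).continuous
  have hclose : ∀ s, ‖g s - γ.1.toFun s‖ ≤ ε := by
    intro s
    have e : g s - γ.1.toFun s =
        (r / 2)⁻¹ • ∫ l in s..(s + r / 2), (γ.1.toFun l - γ.1.toFun s) := by
      rw [intervalIntegral.integral_sub (hii _ _) intervalIntegrable_const,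
        intervalIntegral.integral_const, add_sub_cancel_left, smul_sub, smul_smul,
        inv_mul_cancel₀ hr2.ne', one_smul]
    rw [e, norm_smul, Real.norm_of_nonneg (by positivity)]
    have h1 := intervalIntegral.norm_integral_le_of_norm_le_const (a := s) (b := s + r / 2)
      (f := fun l => γ.1.toFun l - γ.1.toFun s) (C := ε) ?_
    · rw [add_sub_cancel_left, abs_of_pos hr2] at h1
      calc _ ≤ (r / 2)⁻¹ * (ε * (r / 2)) := mul_le_mul_of_nonneg_left h1 (by positivity)
        _ = ε := by field_simp
    · intro l hl
      rw [uIoc_of_le (by linarith)] at hl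
      refine (hmod l s ?_).le
      rw [abs_of_pos (by linarith [hl.1])]
      linarith [hl.2]
  refine ⟨clampPath γ.1.time γ.1.time_mem g hgc, rfl, ?_, _, hK, fun l s => ?_⟩
  · change dist (clampPath γ.1.time γ.1.time_mem g hgc).1 γ.1 ≤ ε
    rw [CadlagPath.dist_eq_supDist (γ := (clampPath γ.1.time γ.1.time_mem g hgc).1) (η := γ.1) rfl]
    refine CadlagPath.supDist_le fun s => ?_
    rw [clampPath_apply, γ.1.toFun_clamp s]
    exact hclose _
  · rw [clampPath_apply, clampPath_apply]
    exact (hlip _ _).trans (mul_le_mul_of_nonneg_left (abs_clamp_sub_le _ _ _) hK)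

/-! ### Extension of paths with constant velocity. -/

theorem CadlagPath.toFun_min_time (γ : CadlagPath d T) (s : ℝ) :
    γ.toFun (min s γ.time) = γ.toFun s := by
  rcases le_total s γ.time with h | h
  · rw [min_eq_left h]
  · rw [min_eq_right h, γ.const_right s h]

/-- The extension of a path beyond its final time with constant velocity `v`, up to time `t`. -/
noncomputable def extend (γ : ContPath d T) (v : EuclideanSpace ℝ (Fin d)) (t : ℝ) :
    ContPath d T :=
  clampPath (max γ.1.time (min t T))
    ⟨γ.1.time_mem.1.trans (le_max_left _ _), max_le γ.1.time_mem.2 (min_le_right _ _)⟩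
    (fun s => γ.1.toFun s + max (s - γ.1.time) 0 • v)
    (γ.2.add (by fun_prop))

section extend

variable {γ : ContPath d T} {v : EuclideanSpace ℝ (Fin d)} {t : ℝ}

theorem extend_time (h : γ.1.time ≤ t) (h' : t ≤ T) : (extend γ v t).1.time = t := by
  change max γ.1.time (min t T) = t
  rw [min_eq_left h', max_eq_right h]

theorem extend_apply (h : γ.1.time ≤ t) (h' : t ≤ T) (s : ℝ) :
    (extend γ v t).1.toFun s = γ.1.toFun s + max (min s t - γ.1.time) 0 • v := by
  have h0 := γ.1.time_mem.1
  change γ.1.toFun (max 0 (min s (max γ.1.time (min t T)))) +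
    max (max 0 (min s (max γ.1.time (min t T))) - γ.1.time) 0 • v = _
  rw [min_eq_left h', max_eq_right h]
  rcases le_total s 0 with hs | hs
  · rw [min_eq_left (hs.trans (h0.trans h)), max_eq_left hs, γ.1.const_left s hs,
      max_eq_right (by linarith), max_eq_right (by linarith)]
  · rw [max_eq_right (le_min hs (h0.trans h))]
    rcases le_total s t with hst | hst
    · rw [min_eq_left hst]
    · rw [min_eq_right hst, γ.1.const_right t h, γ.1.const_right s (h.trans hst)]

theorem extend_end (h : γ.1.time ≤ t) (h' : t ≤ T) {s : ℝ} (hs : t ≤ s) :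
    (extend γ v t).1.toFun s = γ.1.toFun γ.1.time + (t - γ.1.time) • v := by
  rw [extend_apply h h', min_eq_right hs, γ.1.const_right s (h.trans hs),
    max_eq_left (by linarith)]

theorem extend_apply_eq (h : γ.1.time ≤ t) (h' : t ≤ T) {s : ℝ} (hs : s ≤ t) :
    (extend γ v t).1.toFun s = (extend γ v T).1.toFun s := by
  rw [extend_apply h h', extend_apply (h.trans h') le_rfl, min_eq_left hs,
    min_eq_left (hs.trans h')]

theorem extend_self : extend γ v γ.1.time = γ := by
  refine Subtype.ext (CadlagPath.ext (extend_time le_rfl γ.1.time_mem.2) (funext fun s => ?_))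
  rw [extend_apply le_rfl γ.1.time_mem.2, max_eq_right (by linarith [min_le_right s γ.1.time]),
    zero_smul, add_zero]

theorem dist_extend_le (h : γ.1.time ≤ t) (h' : t ≤ T) {s : ℝ} (hs : γ.1.time ≤ s) (hs' : s ≤ T) :
    dist (extend γ v t) (extend γ v s) ≤ (1 + ‖v‖) * |t - s| := by
  change |(extend γ v t).1.time - (extend γ v s).1.time| +
    CadlagPath.supDist (extend γ v t).1 (extend γ v s).1 ≤ _
  rw [extend_time h h', extend_time hs hs', add_mul, one_mul]
  refine add_le_add le_rfl (CadlagPath.supDist_le fun r => ?_)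
  rw [extend_apply h h', extend_apply hs hs', add_sub_add_left_eq_sub, ← sub_smul, norm_smul,
    mul_comm]
  refine mul_le_mul_of_nonneg_left ?_ (norm_nonneg _)
  rw [Real.norm_eq_abs]
  refine (abs_max_sub_max_le_abs _ _ _).trans ?_
  rw [sub_sub_sub_cancel_right]
  simpa using abs_min_sub_min_le_max r t r s

theorem dist_extend_self_le (h : γ.1.time ≤ t) (h' : t ≤ T) :
    dist (extend γ v t) γ ≤ (1 + ‖v‖) * (t - γ.1.time) := by
  have h1 := dist_extend_le (v := v) h h' le_rfl γ.1.time_mem.2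
  rwa [extend_self, abs_of_nonneg (by linarith)] at h1

/-- An increment splits into a part before the old final time and a part after it, whose lengths add
up to at most `|l - r|`; both have slope at most `μ (1 + M)`. -/
theorem extend_mem_lipPaths {μ M a : ℝ} (hK : 0 ≤ μ * (1 + M)) (hγ : γ ∈ lipPaths d T μ a M)
    (h : γ.1.time ≤ t) (h' : t ≤ T) (hv : ‖v‖ ≤ μ * (1 + M))
    (hM : ‖γ.1.toFun γ.1.time‖ + (t - γ.1.time) * ‖v‖ ≤ M) :
    extend γ v t ∈ lipPaths d T μ γ.1.time M := by
  refine mem_lipPaths (by rwa [extend_time h h']) (fun s => ?_) ?_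
  · rw [extend_apply h h']
    rcases le_total s γ.1.time with hs | hs
    · rw [min_eq_left (hs.trans h), max_eq_right (by linarith), zero_smul, add_zero]
      exact norm_le_of_mem_lipPaths hγ s
    · rw [γ.1.const_right s hs, max_eq_left (by linarith [le_min hs h])]
      refine (norm_add_le _ _).trans ?_
      rw [norm_smul, Real.norm_of_nonneg (by linarith [le_min hs h])]
      nlinarith [min_le_right s t, norm_nonneg v]
  · have key : ∀ l r : ℝ, l ≤ r → ‖(extend γ v t).1.toFun l - (extend γ v t).1.toFun r‖ ≤
        μ * (1 + M) * |l - r| := by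
      intro l r hlr
      rw [extend_apply h h', extend_apply h h', add_sub_add_comm, ← sub_smul]
      refine (norm_add_le _ _).trans ?_
      rw [← γ.1.toFun_min_time l, ← γ.1.toFun_min_time r, norm_smul]
      have h1 := norm_sub_le_of_mem_lipPaths hK hγ (min l γ.1.time) (min r γ.1.time)
      have h2 : ‖max (min l t - γ.1.time) 0 - max (min r t - γ.1.time) 0‖ * ‖v‖ ≤
          ‖max (min l t - γ.1.time) 0 - max (min r t - γ.1.time) 0‖ * (μ * (1 + M)) :=
        mul_le_mul_of_nonneg_left hv (norm_nonneg _)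
      have h3 : |min l γ.1.time - min r γ.1.time| +
          ‖max (min l t - γ.1.time) 0 - max (min r t - γ.1.time) 0‖ ≤ |l - r| := by
        have m1 : min l γ.1.time ≤ min r γ.1.time := min_le_min_right _ hlr
        have m2 : max (min l t - γ.1.time) 0 ≤ max (min r t - γ.1.time) 0 :=
          max_le_max_right _ (sub_le_sub_right (min_le_min_right _ hlr) _)
        rw [Real.norm_eq_abs, abs_sub_comm, abs_of_nonneg (sub_nonneg.2 m1), abs_sub_comm,
          abs_of_nonneg (sub_nonneg.2 m2), abs_sub_comm, abs_of_nonneg (sub_nonneg.2 hlr)]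
        rcases le_total l γ.1.time with a1 | a1 <;> rcases le_total r γ.1.time with a2 | a2 <;>
          rcases le_total l t with a3 | a3 <;> rcases le_total r t with a4 | a4 <;>
          simp only [min_eq_left a1, min_eq_right a1, min_eq_left a2, min_eq_right a2,
            min_eq_left a3, min_eq_right a3, min_eq_left a4, min_eq_right a4] <;>
          simp only [max_def] <;> split_ifs <;> linarith
      nlinarith [mul_le_mul_of_nonneg_left h3 hK]
    intro l r
    rcases le_total l r with hlr | hlr
    · exact key l r hlr
    · rw [norm_sub_rev, abs_sub_comm]
      exact key r l hlr

/-- Only times before the end of `η` are integrated, where all extensions agree. One reference path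
`extend γ v T` thus serves every final time, so the penalty is a functional against a fixed path. -/
theorem sqDist_extend {η : ContPath d T} (h : γ.1.time ≤ η.1.time) :
    η.1.sqDist (extend γ v η.1.time).1 = η.1.sqDist (extend γ v T).1 := by
  refine intervalIntegral.integral_congr_Ioo_of_le η.1.time_mem.1 fun l hl => ?_
  rw [extend_apply_eq h η.1.time_mem.2 hl.2.le]

theorem sqDist_extend_self {η : ContPath d T} (h : η.1.time = γ.1.time) :
    η.1.sqDist (extend γ v T).1 = η.1.sqDist γ.1 := by
  have h1 := sqDist_extend (v := v) h.ge
  rw [← h1, h, extend_self]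

end extend

/-! ### Test functionals, the Hamiltonian and the penalty estimates. -/

/-- Squared positive parts are `C¹`, so they can serve as barriers that contribute no derivative
where they are inactive. -/
theorem hasDerivAt_sq_max_zero (x : ℝ) :
    HasDerivAt (fun x : ℝ => max x 0 ^ 2) (2 * max x 0) x := by
  rcases lt_trichotomy x 0 with h | h | h
  · rw [max_eq_right h.le, mul_zero]
    refine (hasDerivAt_const x (0 : ℝ)).congr_of_eventuallyEq ?_
    filter_upwards [Iio_mem_nhds h] with y hy
    rw [max_eq_right (mem_Iio.1 hy).le]
    norm_num
  · subst h
    rw [max_self, mul_zero, hasDerivAt_iff_isLittleO]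
    simp only [max_self, sub_zero, smul_zero, ne_eq, OfNat.ofNat_ne_zero, not_false_eq_true,
      zero_pow]
    refine Asymptotics.IsBigO.trans_isLittleO (g := fun x : ℝ => x ^ 2) ?_ ?_
    · refine Asymptotics.IsBigO.of_bound 1 (Eventually.of_forall fun y => ?_)
      rw [one_mul, norm_pow, norm_pow]
      refine pow_le_pow_left₀ (norm_nonneg _) ?_ 2
      rw [Real.norm_of_nonneg (le_max_right _ _)]
      exact max_le (le_abs_self _) (abs_nonneg _)
    · exact Asymptotics.isLittleO_pow_id (by norm_num)
  · rw [max_eq_left h.le]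
    have h1 : HasDerivAt (fun x : ℝ => x ^ 2) (2 * x) x := by simpa using hasDerivAt_pow 2 x
    refine h1.congr_of_eventuallyEq ?_
    filter_upwards [Ioi_mem_nhds h] with y hy
    rw [max_eq_left (mem_Ioi.1 hy).le]

theorem hasGradientAt_mul_norm_sub_sq (c : ℝ) (a x : EuclideanSpace ℝ (Fin d)) :
    HasGradientAt (fun y => c * ‖y - a‖ ^ 2) ((2 * c) • (x - a)) x := by
  rw [hasGradientAt_iff_hasFDerivAt]
  have h1 := (((hasFDerivAt_id x).sub_const a).norm_sq).const_mul c
  refine h1.congr_fderiv ?_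
  ext y
  simp
  ring

open CadlagPath in
/-- Pathwise derivatives of the penalty against a path moving with constant velocity. -/
theorem hasPathDerivsCont_penalty (hT : 0 < T) (γ : ContPath d T)
    (v : EuclideanSpace ℝ (Fin d)) (b c t : ℝ)
    {G Gt : ℝ → EuclideanSpace ℝ (Fin d) → ℝ}
    {Gx : ℝ → EuclideanSpace ℝ (Fin d) → EuclideanSpace ℝ (Fin d)}
    (hG : Continuous fun p : ℝ × EuclideanSpace ℝ (Fin d) => G p.1 p.2)
    (hGt : Continuous fun p : ℝ × EuclideanSpace ℝ (Fin d) => Gt p.1 p.2)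
    (hGx : Continuous fun p : ℝ × EuclideanSpace ℝ (Fin d) => Gx p.1 p.2)
    (ht : ∀ s x, HasDerivAt (fun r => G r x) (Gt s x) s)
    (hx : ∀ s x, HasGradientAt (G s) (Gx s x) x) :
    HasPathDerivsCont t
      (fun η : ContPath d T => b * η.1.sqDist (extend γ v T).1 +
        (c * ‖η.1.toFun η.1.time - (γ.1.toFun γ.1.time + (η.1.time - γ.1.time) • v)‖ ^ 2 +
          G η.1.time (η.1.toFun η.1.time)))
      (fun η => b * ‖η.endLeft - (extend γ v T).1.toFun η.time‖ ^ 2 +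
        (-(2 * c * inner ℝ (η.endLeft - (γ.1.toFun γ.1.time + (η.time - γ.1.time) • v)) v) +
          Gt η.time η.endLeft))
      (fun η => (2 * c) • (η.toFun η.time - (γ.1.toFun γ.1.time + (η.time - γ.1.time) • v)) +
        Gx η.time (η.toFun η.time)) := by
  refine ⟨_, hasPathDerivs_sqDist_add hT (extend γ v T) b t
    (g := fun s x => c * ‖x - (γ.1.toFun γ.1.time + (s - γ.1.time) • v)‖ ^ 2 + G s x)
    (gt := fun s x =>
      -(2 * c * inner ℝ (x - (γ.1.toFun γ.1.time + (s - γ.1.time) • v)) v) + Gt s x)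
    (gx := fun s x => (2 * c) • (x - (γ.1.toFun γ.1.time + (s - γ.1.time) • v)) + Gx s x)
    ?_ ?_ ?_ ?_ ?_, fun η _ => rfl⟩
  · exact Continuous.add (by fun_prop) hG
  · exact Continuous.add (by fun_prop) hGt
  · exact Continuous.add (by fun_prop) hGx
  · intro s x
    refine HasDerivAt.add ?_ (ht s x)
    have h1 : HasDerivAt (fun r : ℝ => x - (γ.1.toFun γ.1.time + (r - γ.1.time) • v)) (-v) s := by
      have := ((((hasDerivAt_id s).sub_const γ.1.time).smul_const v).const_add
        (γ.1.toFun γ.1.time)).const_sub x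
      simpa using this
    have h2 := (h1.norm_sq).const_mul c
    refine h2.congr_deriv ?_
    rw [inner_neg_right]
    ring
  · intro s x
    have h1 := hasGradientAt_mul_norm_sub_sq c (γ.1.toFun γ.1.time + (s - γ.1.time) • v) x
    rw [hasGradientAt_iff_hasFDerivAt] at h1 ⊢
    have h2 := (hx s x).hasFDerivAt
    rw [map_add]
    exact h1.add h2

theorem exists_lt_hamiltonian_add {U : Type*} [Nonempty U]
    {F : ContPath d T → U → EuclideanSpace ℝ (Fin d)} {q : ContPath d T → U → ℝ} (γ : ContPath d T)
    (p : EuclideanSpace ℝ (Fin d)) {ε : ℝ} (hε : 0 < ε) :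
    ∃ u : U, inner ℝ p (F γ u) + q γ u < hamiltonian F q γ p + ε :=
  exists_lt_of_ciInf_lt (lt_add_of_pos_right _ hε)

section hamiltonian

variable {U : Type*} [MetricSpace U] {F : ContPath d T → U → EuclideanSpace ℝ (Fin d)}
  {q : ContPath d T → U → ℝ} {ϕ : TerminalPath d T → ℝ} {L : ℝ}

theorem Coefficients.bddBelow (h : Coefficients F q ϕ L) (γ : ContPath d T)
    (p : EuclideanSpace ℝ (Fin d)) :
    BddBelow (range fun u : U => inner ℝ p (F γ u) + q γ u) := by
  refine ⟨-(‖p‖ * (L * (1 + γ.1.supNorm)) + L * (1 + γ.1.supNorm)), ?_⟩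
  rintro _ ⟨u, rfl⟩
  have h1 := (abs_le.1 (abs_real_inner_le_norm p (F γ u))).1
  have h2 := mul_le_mul_of_nonneg_left (h.growth_F γ u) (norm_nonneg p)
  have h3 := (abs_le.1 (h.growth_q γ u)).1
  change _ ≤ inner ℝ p (F γ u) + q γ u
  linarith

theorem Coefficients.hamiltonian_le (h : Coefficients F q ϕ L) (γ : ContPath d T)
    (p : EuclideanSpace ℝ (Fin d)) (u : U) :
    hamiltonian F q γ p ≤ inner ℝ p (F γ u) + q γ u :=
  ciInf_le (h.bddBelow γ p) u

end hamiltonian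

theorem HasPathDerivsCont.continuous {φ : ContPath d T → ℝ} {φt : CadlagPath d T → ℝ}
    {φx : CadlagPath d T → EuclideanSpace ℝ (Fin d)} (h : HasPathDerivsCont 0 φ φt φx) :
    Continuous φ := by
  obtain ⟨f, hf, hfφ⟩ := h
  have h1 : Continuous fun γ : ContPath d T => f γ.1 :=
    hf.continuousOn.comp_continuous continuous_subtype_val fun γ => γ.1.time_mem.1
  exact h1.congr fun γ => hfφ γ γ.1.time_mem.1

theorem mem_testAbove {μ M t : ℝ} {η : ContPath d T} {w φ : ContPath d T → ℝ}
    {φt : CadlagPath d T → ℝ} {φx : CadlagPath d T → EuclideanSpace ℝ (Fin d)}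
    (hφ : HasPathDerivsCont η.1.time φ φt φx) (hη : η ∈ lipPaths d T μ t M)
    (h0 : w η = φ η) (hle : ∀ ζ ∈ lipPaths d T μ η.1.time M, w ζ ≤ φ ζ) :
    φ ∈ testAbove μ M η w := by
  refine ⟨⟨φt, φx, hφ⟩, sub_eq_zero.2 h0, ?_, fun c hc => ?_⟩
  · rintro _ ⟨ζ, hζ, rfl⟩
    exact sub_nonpos.2 (hle ζ hζ)
  · exact hc ⟨η, ⟨le_rfl, hη.2⟩, sub_eq_zero.2 h0⟩

theorem mem_testBelow {μ M t : ℝ} {η : ContPath d T} {w φ : ContPath d T → ℝ}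
    {φt : CadlagPath d T → ℝ} {φx : CadlagPath d T → EuclideanSpace ℝ (Fin d)}
    (hφ : HasPathDerivsCont η.1.time φ φt φx) (hη : η ∈ lipPaths d T μ t M)
    (h0 : w η + φ η = 0) (hle : ∀ ζ ∈ lipPaths d T μ η.1.time M, 0 ≤ w ζ + φ ζ) :
    φ ∈ testBelow μ M η w := by
  refine ⟨⟨φt, φx, hφ⟩, h0, ?_, fun c hc => ?_⟩
  · rintro _ ⟨ζ, hζ, rfl⟩
    exact hle ζ hζ
  · exact hc ⟨η, ⟨le_rfl, hη.2⟩, h0⟩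

/-- The difference of the two paths has Lipschitz constant `2 μ (1 + M)`, which bounds `b` times the
uniform distance; multiplying the hypothesis by `b` then bounds the end gap. Both bounds are
independent of `b`, and the first also of `N`. -/
theorem penalty_estimates {μ M s t b N C : ℝ} (hK : 0 < μ * (1 + M)) {γ η : ContPath d T}
    (hγ : γ ∈ lipPaths d T μ s M) (hη : η ∈ lipPaths d T μ t M) (ht : γ.1.time = η.1.time)
    (hb : 0 < b) (hN : 1 ≤ N) (hC : 0 ≤ C)
    (h : b ^ 2 * γ.1.sqDist η.1 + N * b * ‖γ.1.toFun γ.1.time - η.1.toFun γ.1.time‖ ^ 2 ≤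
      C * γ.1.supDist η.1) :
    b * γ.1.supDist η.1 ≤ 16 * (2 * (μ * (1 + M))) * C + 4 * C + 1 ∧
      N * (b * ‖γ.1.toFun γ.1.time - η.1.toFun γ.1.time‖) ^ 2 ≤
        C * (16 * (2 * (μ * (1 + M))) * C + 4 * C + 1) := by
  have h1 : b * γ.1.supDist η.1 ≤ 16 * (2 * (μ * (1 + M))) * C + 4 * C + 1 := by
    refine mul_supDist_le_of_penalty ht (by positivity) (fun l r => ?_) hb hN hC h
    have e : (γ.1.toFun l - η.1.toFun l) - (γ.1.toFun r - η.1.toFun r) =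
        (γ.1.toFun l - γ.1.toFun r) - (η.1.toFun l - η.1.toFun r) := by abel
    rw [e]
    refine (norm_sub_le _ _).trans ?_
    linarith [norm_sub_le_of_mem_lipPaths hK.le hγ l r, norm_sub_le_of_mem_lipPaths hK.le hη l r]
  refine ⟨h1, ?_⟩
  have h2 := mul_le_mul_of_nonneg_left h hb.le
  have h3 : 0 ≤ b * (b ^ 2 * γ.1.sqDist η.1) := by
    have := γ.1.sqDist_nonneg η.1
    positivity
  have h4 := mul_le_mul_of_nonneg_left h1 hC
  calc _ = b * (N * b * ‖γ.1.toFun γ.1.time - η.1.toFun γ.1.time‖ ^ 2) := by ring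
    _ ≤ b * (C * γ.1.supDist η.1) := by linarith
    _ ≤ _ := by linarith

theorem LocallyLipschitzBound.abs_sub_le {L μ M s t : ℝ} (hL : 0 ≤ L) {W : ContPath d T → ℝ}
    (h : LocallyLipschitzBound L W) {γ η : ContPath d T} (hγ : γ ∈ lipPaths d T μ s M)
    (hη : η ∈ lipPaths d T μ t M) : |W γ - W η| ≤ L * (1 + M) * dist γ η :=
  (h γ η).trans (mul_le_mul_of_nonneg_right
    (mul_le_mul_of_nonneg_left (by linarith [max_le hγ.2.1 hη.2.1]) hL) dist_nonneg)

theorem LinearGrowth.abs_le {L μ M t : ℝ} (hL : 0 ≤ L) {W : ContPath d T → ℝ}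
    (h : LinearGrowth L W) {γ : ContPath d T} (hγ : γ ∈ lipPaths d T μ t M) :
    |W γ| ≤ L * (1 + M) :=
  (h γ).trans (mul_le_mul_of_nonneg_left (by linarith [hγ.2.1]) hL)

theorem dist_eq_supDist {γ η : ContPath d T} (h : γ.1.time = η.1.time) :
    dist γ η = γ.1.supDist η.1 :=
  CadlagPath.dist_eq_supDist h

/-- Turns a strict loss at the end of an interval into a uniform loss near the end, which will keep
a maximum point away from there. -/
theorem exists_le_sub_of_continuousOn {f : ℝ → ℝ} {s t : ℝ} (hst : s < t)
    (hf : ContinuousOn f (Icc s t)) (h : f t < f s) :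
    ∃ δ > 0, ∃ r, s < r ∧ r < t ∧ ∀ x ∈ Icc r t, f x ≤ f s - δ := by
  have h1 : ∀ᶠ x in 𝓝[Icc s t] t, f x < (f s + f t) / 2 :=
    (hf t (right_mem_Icc.2 hst.le)).eventually (gt_mem_nhds (by linarith))
  obtain ⟨r, hr, hr'⟩ := Metric.mem_nhdsWithin_iff.1 h1
  refine ⟨(f s - f t) / 2, by linarith, max ((s + t) / 2) (t - r / 2),
    lt_max_of_lt_left (by linarith), max_lt (by linarith) (by linarith), fun x hx => ?_⟩
  have hx1 := (le_max_left _ _).trans hx.1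
  have hx2 := (le_max_right _ _).trans hx.1
  have h2 : f x < (f s + f t) / 2 := hr' ⟨by
    rw [Metric.mem_ball, Real.dist_eq, abs_sub_comm, abs_of_nonneg (by linarith [hx.2])]
    linarith, by linarith, hx.2⟩
  linarith

/-! ### The subsolution along controlled motions. -/

section

variable {U : Type*} [MetricSpace U] {F : ContPath d T → U → EuclideanSpace ℝ (Fin d)}
  {q : ContPath d T → U → ℝ} {ϕ : TerminalPath d T → ℝ} {L₀ : ℝ}

/-- Here `a` is the rate of decrease to be refuted, the `k` term is a barrier that is inactive up to
time `r`, and `c₀` normalizes the contact value. -/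
theorem hasPathDerivsCont_time_penalty (hT : 0 < T) (γ : ContPath d T)
    (v : EuclideanSpace ℝ (Fin d)) (b c a k r c₀ t : ℝ) :
    HasPathDerivsCont t
      (fun η : ContPath d T => b * η.1.sqDist (extend γ v T).1 +
        (c * ‖η.1.toFun η.1.time - (γ.1.toFun γ.1.time + (η.1.time - γ.1.time) • v)‖ ^ 2 +
          (-(a * (η.1.time - γ.1.time)) + k * max (η.1.time - r) 0 ^ 2 + c₀)))
      (fun η => b * ‖η.endLeft - (extend γ v T).1.toFun η.time‖ ^ 2 +
        (-(2 * c * inner ℝ (η.endLeft - (γ.1.toFun γ.1.time + (η.time - γ.1.time) • v)) v) +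
          (-a + k * (2 * max (η.time - r) 0))))
      (fun η => (2 * c) • (η.toFun η.time - (γ.1.toFun γ.1.time + (η.time - γ.1.time) • v)) +
        0) := by
  refine hasPathDerivsCont_penalty hT γ v b c t
    (G := fun s _ => -(a * (s - γ.1.time)) + k * max (s - r) 0 ^ 2 + c₀)
    (Gt := fun s _ => -a + k * (2 * max (s - r) 0)) (Gx := fun _ _ => 0)
    (by fun_prop) (by fun_prop) (by fun_prop) (fun s x => ?_) (fun s x => hasGradientAt_const _ _)
  have h1 : HasDerivAt (fun s : ℝ => -(a * (s - γ.1.time))) (-a) s := by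
    exact ((((hasDerivAt_id s).sub_const γ.1.time).const_mul a).neg).congr_deriv (by simp)
  have h2 : HasDerivAt (fun s : ℝ => max (s - r) 0 ^ 2) (2 * max (s - r) 0) s := by
    exact (hasDerivAt_sq_max_zero (s - r)).comp_sub_const s r
  exact (h1.add (h2.const_mul k)).add_const c₀

/-- The viscosity inequality of a subsolution at a maximum point of the penalized functional. -/
theorem IsMuSubsolution.penalty_inequality (hT : 0 < T) (hc : Coefficients F q ϕ L₀)
    {W : ContPath d T → ℝ} {μ M : ℝ} (hM : 0 < M) (hW : IsMuSubsolution F q ϕ μ W)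
    {γ η : ContPath d T} {v : EuclideanSpace ℝ (Fin d)} {b c a k r : ℝ}
    (hη : η ∈ lipPaths d T μ γ.1.time M)
    (hmax : IsMaxOn (fun η : ContPath d T => W η - (b * η.1.sqDist (extend γ v T).1 +
        (c * ‖η.1.toFun η.1.time - (γ.1.toFun γ.1.time + (η.1.time - γ.1.time) • v)‖ ^ 2 +
          (-(a * (η.1.time - γ.1.time)) + k * max (η.1.time - r) 0 ^ 2 + 0))))
        (lipPaths d T μ γ.1.time M) η)
    (hηr : η.1.time ≤ r) (hηT : η.1.time < T) (hηM : ‖η.1.toFun η.1.time‖ < M) (u : U) :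
    a ≤ b * ‖η.1.toFun η.1.time - (extend γ v η.1.time).1.toFun η.1.time‖ ^ 2 +
      2 * c * inner ℝ (η.1.toFun η.1.time - (extend γ v η.1.time).1.toFun η.1.time)
        (F η u - v) + q η u := by
  set c₀ := W η - (b * η.1.sqDist (extend γ v T).1 +
        (c * ‖η.1.toFun η.1.time - (γ.1.toFun γ.1.time + (η.1.time - γ.1.time) • v)‖ ^ 2 +
          (-(a * (η.1.time - γ.1.time)) + k * max (η.1.time - r) 0 ^ 2 + 0))) with hc₀
  have hφ := hasPathDerivsCont_time_penalty hT γ v b c a k r c₀ η.1.time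
  have hη0 : η ∈ lipPaths d T μ 0 M := lipPaths_anti γ.1.time_mem.1 hη
  have key := hW.2 M hM η hη0 hηT hηM _ (mem_testAbove hφ hη (by rw [hc₀]; ring)
    (fun ζ hζ => by
      have h1 : W ζ - _ ≤ W η - _ := hmax (lipPaths_anti hη.1 hζ)
      rw [hc₀]
      linarith)) _ _ hφ
  have hH := hc.hamiltonian_le η
    ((2 * c) • (η.1.toFun η.1.time - (γ.1.toFun γ.1.time + (η.1.time - γ.1.time) • v)) + 0) u
  rw [CadlagPath.endLeft_eq hηT, max_eq_right (by linarith),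
    ← extend_apply_eq (v := v) hη.1 hηT.le le_rfl] at key
  have e : (extend γ v η.1.time).1.toFun η.1.time =
      γ.1.toFun γ.1.time + (η.1.time - γ.1.time) • v := extend_end hη.1 hηT.le le_rfl
  rw [← e] at key hH
  rw [add_zero, inner_smul_left] at hH
  rw [add_zero] at key
  rw [inner_sub_right]
  simp only [conj_trivial] at hH
  linarith

-- If the inequality fails at `t₁`, then `W` plus `a` times the elapsed time, penalized against the
-- extension and with a late-time barrier, has a maximum point close to the extension and before the
-- barrier sets in. The viscosity inequality there contradicts `a = q γ u + ε`.
set_option maxHeartbeats 800000 in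
theorem IsMuSubsolution.sub_le_extend_aux (hT : 0 < T) (hL₀ : 0 < L₀)
    (hc : Coefficients F q ϕ L₀) {W : ContPath d T → ℝ} {μ M L C C₂ N Q κ ε m : ℝ}
    (hK : 0 < μ * (1 + M)) (hM : 0 < M)
    (hW : IsMuSubsolution F q ϕ μ W) (hWc : Continuous W) (hL : 0 < L) (hg : LinearGrowth L W)
    (hl : LocallyLipschitzBound L W) {γ : ContPath d T} (hγ : γ ∈ lipPaths d T μ 0 M)
    (u : U) (hε : 0 < ε) (hC : C = L * (1 + M))
    (hC₂ : C₂ = 16 * (2 * (μ * (1 + M))) * C + 4 * C + 1) (hN : 1 ≤ N)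
    (hNε : C * C₂ ≤ N * (ε / 4)) (hQ : Q = N * (C * C₂) + 1) (hQκ : 2 * Q * κ = ε / 8)
    (hm : 0 < m) {t₁ : ℝ} (ht₁T : t₁ ≤ T) (hγt₁ : γ.1.time < t₁)
    (hX : ∀ t ∈ Icc γ.1.time t₁, extend γ (F γ u) t ∈ lipPaths d T μ γ.1.time M ∧
      ‖F (extend γ (F γ u) t) u - F γ u‖ ≤ κ ∧ |q (extend γ (F γ u) t) u - q γ u| ≤ ε / 4 ∧
      ‖(extend γ (F γ u) t).1.toFun t‖ + m ≤ M) :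
    W γ - (t₁ - γ.1.time) * (q γ u + ε) ≤ W (extend γ (F γ u) t₁) := by
  by_contra hcon
  push Not at hcon
  set v := F γ u with hv
  set τ := γ.1.time with hτ
  set a := q γ u + ε with ha
  have hM1 : 0 < 1 + M := by linarith
  have hC0 : 0 < C := by rw [hC]; positivity
  have hC₂0 : 0 < C₂ := by rw [hC₂]; positivity
  have hQ0 : 0 < Q := by rw [hQ]; positivity
  have hXτ : extend γ v τ = γ := extend_self
  obtain ⟨δ, hδ, t₂, hτt₂, ht₂, hθ⟩ := exists_le_sub_of_continuousOn
    (f := fun t => W (extend γ v t) + (t - τ) * a) hγt₁ (by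
      have h1 : ContinuousOn (fun t => extend γ v t) (Icc τ t₁) :=
        (LipschitzOnWith.of_dist_le_mul (K := ⟨1 + ‖v‖, by positivity⟩) fun s hs t ht =>
          dist_extend_le hs.1 (hs.2.trans ht₁T) ht.1 (ht.2.trans ht₁T)).continuousOn
      exact (hWc.comp_continuousOn h1).add (by fun_prop))
    (by
      rw [hXτ]
      linarith)
  simp only [hXτ, sub_self, zero_mul, add_zero] at hθ
  have ht21 : 0 < t₁ - t₂ := by linarith
  -- From `t₁` on the barrier outweighs the largest possible gain from `W` and from the term in `a`.
  obtain ⟨K₁, hK₁0, hK₁e⟩ : ∃ K₁, 0 ≤ K₁ ∧ K₁ * (t₁ - t₂) ^ 2 = 2 * C + |a| * T + 1 :=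
    ⟨(2 * C + |a| * T + 1) / (t₁ - t₂) ^ 2, by positivity, by field_simp⟩
  -- The uniform distance at the maximum is at most `C₂ / b`; this makes it small against `δ`, the
  -- margin `m` and `ε`.
  obtain ⟨b, hb, hb1, hb2, hb3⟩ : ∃ b : ℝ, 0 < b ∧ C₂ * C < b * δ ∧ C₂ < b * m ∧
      C₂ * (L₀ * (2 * Q + 1)) < b * (ε / 8) := by
    have h1 : ∀ x z : ℝ, 0 < z → ∀ᶠ b : ℝ in atTop, x < b * z := fun x z hz =>
      (tendsto_id.atTop_mul_const hz).eventually_gt_atTop x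
    exact ((eventually_gt_atTop 0).and ((h1 _ _ hδ).and ((h1 _ _ hm).and
      (h1 _ _ (by positivity))))).exists
  have hφc := (hasPathDerivsCont_time_penalty hT γ v (b ^ 2) (N * b) a K₁ t₂ 0 0).continuous
  obtain ⟨η, hη, hmax⟩ := (isCompact_lipPaths hT (t := τ) hK.le).exists_isMaxOn
    ⟨γ, le_rfl, hγ.2⟩ (hWc.sub hφc).continuousOn
  set t := η.1.time with ht
  have hηT : t ≤ T := η.1.time_mem.2
  have hτt : τ ≤ t := hη.1
  have hτ0 : 0 ≤ τ := γ.1.time_mem.1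
  have e : ∀ ζ : ContPath d T, τ ≤ ζ.1.time → (extend γ v ζ.1.time).1.toFun ζ.1.time =
      γ.1.toFun τ + (ζ.1.time - τ) • v := fun ζ hζ => extend_end hζ ζ.1.time_mem.2 le_rfl
  have hγmax : W γ ≤ W η - (b ^ 2 * η.1.sqDist (extend γ v T).1 +
        (N * b * ‖η.1.toFun t - (extend γ v t).1.toFun t‖ ^ 2 +
          (-(a * (t - τ)) + K₁ * max (t - t₂) 0 ^ 2 + 0))) := by
    have h1 : W γ - _ ≤ W η - _ := hmax (show γ ∈ lipPaths d T μ τ M from ⟨le_rfl, hγ.2⟩)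
    beta_reduce at h1
    rw [sqDist_extend_self rfl, CadlagPath.sqDist_self, ← hτ, max_eq_right (by linarith)] at h1
    simp only [sub_self, zero_smul, add_zero, norm_zero, mul_zero, ne_eq, OfNat.ofNat_ne_zero,
      not_false_eq_true, zero_pow, neg_zero, sub_zero] at h1
    rw [e η hτt, add_zero]
    exact h1
  have hJ0 : 0 ≤ b ^ 2 * η.1.sqDist (extend γ v T).1 :=
    mul_nonneg (by positivity) (CadlagPath.sqDist_nonneg _ _)
  have hE0 : 0 ≤ N * b * ‖η.1.toFun t - (extend γ v t).1.toFun t‖ ^ 2 := by positivity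
  have htt₁ : t ≤ t₁ := by
    by_contra h
    push Not at h
    have h1 : K₁ * (t₁ - t₂) ^ 2 ≤ K₁ * max (t - t₂) 0 ^ 2 := by
      refine mul_le_mul_of_nonneg_left (pow_le_pow_left₀ ht21.le ?_ 2) hK₁0
      exact le_max_of_le_left (by linarith)
    have h2 : a * (t - τ) ≤ |a| * T :=
      mul_le_mul (le_abs_self a) (by linarith) (by linarith) (abs_nonneg _)
    have h3 := (abs_le.1 (hg.abs_le hL.le hη)).2
    have h4 := (abs_le.1 (hg.abs_le hL.le hγ)).1
    rw [← hC] at h3 h4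
    linarith
  obtain ⟨hXm, hXF, hXq, hXM⟩ := hX t ⟨hτt, htt₁⟩
  have hXt : (extend γ v t).1.time = t := extend_time hτt hηT
  -- Against the extension ending at the same time `t`, the time terms cancel and the penalty is
  -- bounded by the increment of `W`.
  have hpen : b ^ 2 * η.1.sqDist (extend γ v t).1 +
      N * b * ‖η.1.toFun η.1.time - (extend γ v t).1.toFun η.1.time‖ ^ 2 ≤
        C * η.1.supDist (extend γ v t).1 := by
    have h1 : W (extend γ v t) - _ ≤ W η - _ := hmax hXm
    beta_reduce at h1
    rw [← sqDist_extend (by rw [hXt]; exact hτt), hXt, CadlagPath.sqDist_self, ← e η hτt,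
      sub_self, norm_zero, ← sqDist_extend (η := η) hτt] at h1
    have h2 := (abs_le.1 (hl.abs_sub_le hL.le hη hXm)).2
    rw [dist_eq_supDist hXt.symm, ← hC] at h2
    have h3 : (0 : ℝ) ^ 2 = 0 := by norm_num
    rw [h3, mul_zero, mul_zero] at h1
    linarith
  obtain ⟨hy, hD⟩ := penalty_estimates hK hη hXm hXt.symm hb hN hC0.le hpen
  rw [← hC₂] at hy hD
  set y := η.1.supDist (extend γ v t).1 with hydef
  have hy0 : 0 ≤ y := CadlagPath.supDist_nonneg _ _
  have hyδ : C * y < δ := by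
    refine lt_of_mul_lt_mul_left ?_ hb.le
    have h1 := mul_le_mul_of_nonneg_left hy hC0.le
    linarith
  have hym : y < m := lt_of_mul_lt_mul_left (hy.trans_lt hb2) hb.le
  have hyε : y * (L₀ * (2 * Q + 1)) < ε / 8 := by
    refine lt_of_mul_lt_mul_left ?_ hb.le
    have h1 := mul_le_mul_of_nonneg_right hy (by positivity : 0 ≤ L₀ * (2 * Q + 1))
    linarith
  -- Maximality gives `W γ ≤ W (extend γ v t) + (t - τ) a + C y`, impossible on `[t₂, t₁]`, where
  -- the loss `δ` exceeds `C y`.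
  have htt₂ : t < t₂ := by
    by_contra h
    have h1 := hθ t ⟨not_lt.1 h, htt₁⟩
    have h2 := (abs_le.1 (hl.abs_sub_le hL.le hη hXm)).2
    rw [dist_eq_supDist hXt.symm, ← hC] at h2
    have h3 : 0 ≤ K₁ * max (t - t₂) 0 ^ 2 := by positivity
    linarith
  have hηM : ‖η.1.toFun t‖ < M := by
    have h1 := norm_sub_norm_le (η.1.toFun t) ((extend γ v t).1.toFun t)
    have h2 := CadlagPath.norm_sub_le_supDist η.1 (extend γ v t).1 t
    linarith
  have key := hW.penalty_inequality hT hc hM hη hmax htt₂.le (by linarith) hηM u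
  change a ≤ b ^ 2 * ‖η.1.toFun t - (extend γ v t).1.toFun t‖ ^ 2 +
      2 * (N * b) * inner ℝ (η.1.toFun t - (extend γ v t).1.toFun t)
        (F η u - v) + q η u at key
  change N * (b * ‖η.1.toFun t - (extend γ v t).1.toFun t‖) ^ 2 ≤ C * C₂ at hD
  set D := η.1.toFun t - (extend γ v t).1.toFun t with hDdef
  have k1 : b ^ 2 * ‖D‖ ^ 2 ≤ ε / 4 := by
    rw [← mul_pow]
    exact le_of_mul_le_mul_left (hD.trans hNε) (by linarith)
  have k2 : N * (b * ‖D‖) ≤ Q := by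
    have h1 : (N * (b * ‖D‖)) ^ 2 ≤ N * (C * C₂) := by
      calc _ = N * (N * (b * ‖D‖) ^ 2) := by ring
        _ ≤ _ := mul_le_mul_of_nonneg_left hD (by linarith)
    have h2 := two_mul_le_add_sq (N * (b * ‖D‖)) 1
    have h3 := sq_nonneg (N * (b * ‖D‖))
    linarith
  have k3 : ‖F η u - v‖ ≤ L₀ * y + κ := by
    have h1 := hc.lipschitz_F η (extend γ v t) u hXt.symm
    have h2 := norm_sub_le_norm_sub_add_norm_sub (F η u) (F (extend γ v t) u) v
    linarith
  have k4 : q η u ≤ q γ u + ε / 4 + L₀ * y := by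
    have h1 := (abs_le.1 (hc.lipschitz_q η (extend γ v t) u hXt.symm)).2
    have h2 := (abs_le.1 hXq).2
    linarith
  have k5 : 2 * (N * b) * inner ℝ D (F η u - v) ≤ 2 * Q * (L₀ * y + κ) := by
    have h1 := real_inner_le_norm D (F η u - v)
    have h2 : 0 ≤ 2 * (N * b) := by positivity
    calc _ ≤ 2 * (N * b) * (‖D‖ * ‖F η u - v‖) := mul_le_mul_of_nonneg_left h1 h2
      _ = 2 * (N * (b * ‖D‖)) * ‖F η u - v‖ := by ring
      _ ≤ _ := mul_le_mul (by linarith) k3 (norm_nonneg _) (by positivity)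
  have k6 : 2 * Q * (L₀ * y + κ) + L₀ * y = y * (L₀ * (2 * Q + 1)) + 2 * Q * κ := by ring
  -- The right side is below `q γ u + 3 ε / 4`.
  rw [ha] at key
  linarith

/-- A subsolution decreases at rate at most `q` along the extension of a path with the velocity
given by a control. -/
theorem IsMuSubsolution.sub_le_extend (hT : 0 < T) (hL₀ : 0 < L₀) (hc : Coefficients F q ϕ L₀)
    {W : ContPath d T → ℝ} {μ M L : ℝ} (hμ : L₀ ≤ μ) (hM : 0 < M)
    (hW : IsMuSubsolution F q ϕ μ W) (hWc : Continuous W) (hL : 0 < L) (hg : LinearGrowth L W)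
    (hl : LocallyLipschitzBound L W) {γ : ContPath d T} (hγ : γ ∈ lipPaths d T μ 0 M)
    (hγT : γ.1.time < T) (hγM : ‖γ.1.toFun γ.1.time‖ < M) (u : U) {ε : ℝ} (hε : 0 < ε) :
    ∃ h₀ : ℝ, 0 < h₀ ∧ γ.1.time + h₀ ≤ T ∧ ∀ t ∈ Icc γ.1.time (γ.1.time + h₀),
      extend γ (F γ u) t ∈ lipPaths d T μ γ.1.time M ∧
      W γ - (t - γ.1.time) * (q γ u + ε) ≤ W (extend γ (F γ u) t) := by
  have hμ0 : 0 < μ := hL₀.trans_le hμ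
  have hK : 0 < μ * (1 + M) := by positivity
  -- Here `L₀ ≤ μ` is essential: controlled motions stay in the Lipschitz class on which the test
  -- inequality is available.
  have hvK : ‖F γ u‖ ≤ μ * (1 + M) :=
    (hc.growth_F γ u).trans (mul_le_mul hμ (by linarith [hγ.2.1])
      (by linarith [γ.1.supNorm_nonneg]) hμ0.le)
  obtain ⟨C, hC⟩ : ∃ C, C = L * (1 + M) := ⟨_, rfl⟩
  have hC0 : 0 < C := by rw [hC]; positivity
  obtain ⟨C₂, hC₂⟩ : ∃ C₂, C₂ = 16 * (2 * (μ * (1 + M))) * C + 4 * C + 1 := ⟨_, rfl⟩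
  have hC₂0 : 0 < C₂ := by rw [hC₂]; positivity
  -- `N`, `Q` and `κ` do not involve `b`, so `h₀` can be fixed before the time `t₁` of a supposed
  -- failure and the `b` that depends on it.
  obtain ⟨N, hN1, hNε⟩ : ∃ N : ℝ, 1 ≤ N ∧ C * C₂ ≤ N * (ε / 4) := by
    refine ((eventually_ge_atTop 1).and
      ((tendsto_id.atTop_mul_const (by positivity : 0 < ε / 4)).eventually_ge_atTop _)).exists
  obtain ⟨Q, hQ⟩ : ∃ Q, Q = N * (C * C₂) + 1 := ⟨_, rfl⟩
  have hQ0 : 0 < Q := by rw [hQ]; positivity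
  obtain ⟨κ, hκ0, hQκ⟩ : ∃ κ, 0 < κ ∧ 2 * Q * κ = ε / 8 :=
    ⟨ε / (16 * Q), by positivity, by field_simp; norm_num⟩
  obtain ⟨r₁, hr₁, hFr⟩ : ∃ r > 0, ∀ Z : ContPath d T, dist Z γ < r →
      ‖F Z u - F γ u‖ < κ ∧ |q Z u - q γ u| < ε / 4 := by
    have h1 : Continuous fun Z : ContPath d T => F Z u :=
      Continuous.comp (f := fun Z : ContPath d T => (Z, u)) hc.continuous_F
        (continuous_id.prodMk continuous_const)
    have h2 : Continuous fun Z : ContPath d T => q Z u :=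
      Continuous.comp (f := fun Z : ContPath d T => (Z, u)) hc.continuous_q
        (continuous_id.prodMk continuous_const)
    obtain ⟨r, hr, h3⟩ := Metric.continuousAt_iff.1 (h1.continuousAt (x := γ)) κ hκ0
    obtain ⟨r', hr', h4⟩ := Metric.continuousAt_iff.1 (h2.continuousAt (x := γ)) (ε / 4)
      (by positivity)
    refine ⟨min r r', lt_min hr hr', fun Z hZ => ⟨?_, ?_⟩⟩
    · rw [← dist_eq_norm]
      exact h3 (hZ.trans_le (min_le_left _ _))
    · rw [← Real.dist_eq]
      exact h4 (hZ.trans_le (min_le_right _ _))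
  have hv1 : 0 < 1 + ‖F γ u‖ := by positivity
  set m := (M - ‖γ.1.toFun γ.1.time‖) / 2 with hm
  have hm0 : 0 < m := by rw [hm]; linarith
  obtain ⟨h₀, hh0, hh1, hh2, hh3⟩ : ∃ h₀ : ℝ, 0 < h₀ ∧ γ.1.time + h₀ ≤ T ∧
      (1 + ‖F γ u‖) * h₀ ≤ m ∧ (1 + ‖F γ u‖) * h₀ < r₁ := by
    have h1 : ∀ c z : ℝ, 0 < z → ∀ᶠ h : ℝ in 𝓝[>] 0, c * h < z := fun c z hz => by
      have : Continuous fun h : ℝ => c * h := by fun_prop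
      have h2 := this.tendsto 0
      rw [mul_zero] at h2
      exact (h2.mono_left nhdsWithin_le_nhds).eventually (gt_mem_nhds hz)
    obtain ⟨h, ⟨ha, hb⟩, hc, hd⟩ := (((eventually_mem_nhdsWithin).and
      (h1 1 (T - γ.1.time) (by linarith))).and ((h1 (1 + ‖F γ u‖) m hm0).and
      (h1 (1 + ‖F γ u‖) r₁ hr₁))).exists
    exact ⟨h, ha, by linarith, hc.le, hd⟩
  have hX : ∀ t ∈ Icc γ.1.time (γ.1.time + h₀),
      extend γ (F γ u) t ∈ lipPaths d T μ γ.1.time M ∧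
      ‖F (extend γ (F γ u) t) u - F γ u‖ ≤ κ ∧ |q (extend γ (F γ u) t) u - q γ u| ≤ ε / 4 ∧
      ‖(extend γ (F γ u) t).1.toFun t‖ + m ≤ M := by
    intro t ht
    have htT : t ≤ T := by linarith [ht.2]
    have h1 : (1 + ‖F γ u‖) * (t - γ.1.time) ≤ (1 + ‖F γ u‖) * h₀ :=
      mul_le_mul_of_nonneg_left (by linarith [ht.2]) hv1.le
    have h2 : (t - γ.1.time) * ‖F γ u‖ ≤ m := by nlinarith [ht.1]
    have h3 := hFr (extend γ (F γ u) t) ((dist_extend_self_le ht.1 htT).trans_lt (by linarith))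
    have h4 : ‖(extend γ (F γ u) t).1.toFun t‖ ≤ ‖γ.1.toFun γ.1.time‖ + m := by
      rw [extend_end ht.1 htT le_rfl]
      refine (norm_add_le _ _).trans (add_le_add le_rfl ?_)
      rw [norm_smul, Real.norm_of_nonneg (by linarith [ht.1])]
      exact h2
    have h5 : ‖γ.1.toFun γ.1.time‖ + m + m = M := by rw [hm]; ring
    exact ⟨extend_mem_lipPaths hK.le hγ ht.1 htT hvK (by linarith), h3.1.le, h3.2.le,
      by linarith⟩
  refine ⟨h₀, hh0, hh1, fun t ht => ⟨(hX t ht).1, ?_⟩⟩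
  rcases ht.1.eq_or_lt with h | h
  · rw [← h, extend_self]
    simp
  · exact hW.sub_le_extend_aux hT hL₀ hc hK hM hWc hL hg hl hγ u hε hC hC₂ hN1 hNε hQ hQκ hm0
      (by linarith [ht.2]) h fun s hs => hX s ⟨hs.1, hs.2.trans ht.2⟩

end

/-! ### Localization in the final value. -/

/-- A function of the final time and the final value that vanishes near a given start, is large
near the sphere of radius `R` for a short time, and decreases along velocities of size at most
`k R / 2`. -/
noncomputable def growth (A R k t₀ s : ℝ) (x : EuclideanSpace ℝ (Fin d)) : ℝ :=
  A * max (‖x‖ ^ 2 / R ^ 2 - k * (s - t₀) - 1 / 4) 0 ^ 2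

/-- The time derivative of `growth`. -/
noncomputable def growthTime (A R k t₀ s : ℝ) (x : EuclideanSpace ℝ (Fin d)) : ℝ :=
  A * (2 * max (‖x‖ ^ 2 / R ^ 2 - k * (s - t₀) - 1 / 4) 0 * (-k))

/-- The space gradient of `growth`. -/
noncomputable def growthGrad (A R k t₀ s : ℝ) (x : EuclideanSpace ℝ (Fin d)) :
    EuclideanSpace ℝ (Fin d) :=
  (A * (2 * max (‖x‖ ^ 2 / R ^ 2 - k * (s - t₀) - 1 / 4) 0 * (2 / R ^ 2))) • x

theorem growth_nonneg {A : ℝ} (hA : 0 ≤ A) (R k t₀ s : ℝ) (x : EuclideanSpace ℝ (Fin d)) :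
    0 ≤ growth A R k t₀ s x :=
  mul_nonneg hA (sq_nonneg _)

theorem hasDerivAt_growth (A R k t₀ s : ℝ) (x : EuclideanSpace ℝ (Fin d)) :
    HasDerivAt (fun r => growth A R k t₀ r x) (growthTime A R k t₀ s x) s := by
  have h1 : HasDerivAt (fun r : ℝ => ‖x‖ ^ 2 / R ^ 2 - k * (r - t₀) - 1 / 4) (-k) s := by
    refine HasDerivAt.congr_deriv ((((((hasDerivAt_id s).sub_const t₀).const_mul k).const_sub
      (‖x‖ ^ 2 / R ^ 2))).sub_const (1 / 4)) (by simp)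
  exact ((hasDerivAt_sq_max_zero (‖x‖ ^ 2 / R ^ 2 - k * (s - t₀) - 1 / 4)).comp s h1).const_mul A

theorem hasGradientAt_growth (A R k t₀ s : ℝ) (x : EuclideanSpace ℝ (Fin d)) :
    HasGradientAt (growth A R k t₀ s) (growthGrad A R k t₀ s x) x := by
  rw [hasGradientAt_iff_hasFDerivAt]
  have h1 : HasFDerivAt (fun y : EuclideanSpace ℝ (Fin d) =>
      ‖y‖ ^ 2 / R ^ 2 - k * (s - t₀) - 1 / 4)
      ((2 / R ^ 2) • (InnerProductSpace.toDual ℝ (EuclideanSpace ℝ (Fin d)) x)) x := by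
    have h2 := ((((hasFDerivAt_id x).norm_sq).const_mul (R ^ 2)⁻¹).sub_const
      (k * (s - t₀))).sub_const (1 / 4)
    refine (h2.congr_fderiv ?_).congr_of_eventuallyEq (Eventually.of_forall fun y => ?_)
    · ext y
      simp
      ring
    · simp only [id]
      ring
  have h3 := ((hasDerivAt_sq_max_zero (‖x‖ ^ 2 / R ^ 2 - k * (s - t₀) - 1 / 4)).comp_hasFDerivAt
    x h1).const_mul A
  refine h3.congr_fderiv ?_
  ext y
  simp [growthGrad]
  ring

theorem continuous_growth (A R k t₀ : ℝ) :
    Continuous fun p : ℝ × EuclideanSpace ℝ (Fin d) => growth A R k t₀ p.1 p.2 := by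
  unfold growth
  fun_prop

theorem continuous_growthTime (A R k t₀ : ℝ) :
    Continuous fun p : ℝ × EuclideanSpace ℝ (Fin d) => growthTime A R k t₀ p.1 p.2 := by
  unfold growthTime
  fun_prop

theorem continuous_growthGrad (A R k t₀ : ℝ) :
    Continuous fun p : ℝ × EuclideanSpace ℝ (Fin d) => growthGrad A R k t₀ p.1 p.2 := by
  unfold growthGrad
  fun_prop

/-- Inside the ball, `‖x‖² / R²` grows along `f` at rate at most `2 L₀`, exactly the rate at which
the threshold in the cutoff rises. The cutoff is therefore harmless for every control. -/
theorem growthTime_add_inner_le {A R L₀ : ℝ} (hA : 0 ≤ A) (hR : 0 < R) (t₀ s : ℝ)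
    {x f : EuclideanSpace ℝ (Fin d)} (hx : ‖x‖ ≤ R) (hf : ‖f‖ ≤ L₀ * R) :
    growthTime A R (2 * L₀) t₀ s x + inner ℝ (growthGrad A R (2 * L₀) t₀ s x) f ≤ 0 := by
  unfold growthTime growthGrad
  set w := max (‖x‖ ^ 2 / R ^ 2 - 2 * L₀ * (s - t₀) - 1 / 4) 0
  have hw : 0 ≤ w := le_max_right _ _
  rw [inner_smul_left]
  simp only [conj_trivial]
  have h1 : inner ℝ x f ≤ R * (L₀ * R) :=
    (real_inner_le_norm x f).trans (mul_le_mul hx hf (norm_nonneg _) hR.le)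
  have h2 : 2 / R ^ 2 * inner ℝ x f ≤ 2 * L₀ := by
    calc _ ≤ 2 / R ^ 2 * (R * (L₀ * R)) := mul_le_mul_of_nonneg_left h1 (by positivity)
      _ = 2 * L₀ := by field_simp
  have h3 := mul_le_mul_of_nonneg_left h2 (by positivity : 0 ≤ A * (2 * w))
  linarith

theorem le_growth {A R k t₀ s M : ℝ} (hA : 0 ≤ A) (hR : 0 < R) {x : EuclideanSpace ℝ (Fin d)}
    (hM : 0 ≤ M) (hMR : 3 / 4 * R ^ 2 ≤ M ^ 2) (hx : M ≤ ‖x‖) (hs : k * (s - t₀) ≤ 1 / 4) :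
    A / 16 ≤ growth A R k t₀ s x := by
  have h1 : 3 / 4 ≤ ‖x‖ ^ 2 / R ^ 2 := by
    rw [le_div_iff₀ (by positivity)]
    exact hMR.trans (pow_le_pow_left₀ hM hx 2)
  -- `3/4 - 1/4 - 1/4 = 1/4`, whose square is the factor `1/16`.
  have h2 : 1 / 4 ≤ max (‖x‖ ^ 2 / R ^ 2 - k * (s - t₀) - 1 / 4) 0 :=
    le_max_of_le_left (by linarith)
  have h3 := mul_le_mul_of_nonneg_left (pow_le_pow_left₀ (by norm_num) h2 2) hA
  unfold growth
  linarith

theorem growth_start {A R k t₀ : ℝ} (hR : 0 < R) {x : EuclideanSpace ℝ (Fin d)}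
    (hx : 2 * ‖x‖ ≤ R) : growth A R k t₀ t₀ x = 0 := by
  have h1 : ‖x‖ ^ 2 / R ^ 2 ≤ 1 / 4 := by
    rw [div_le_iff₀ (by positivity)]
    nlinarith [norm_nonneg x]
  unfold growth
  rw [max_eq_right (by linarith)]
  ring

/-! ### Doubling of paths and comparison on short intervals. -/

/-- The viscosity inequality of a supersolution at a maximum point of the functional with doubled
paths, tested along the motion generated by a control. -/
theorem IsMuSupersolution.doubling_inequality (hT : 0 < T) {U : Type*}
    {F : ContPath d T → U → EuclideanSpace ℝ (Fin d)} {q : ContPath d T → U → ℝ}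
    {ϕ : TerminalPath d T → ℝ} {W₁ W₂ : ContPath d T → ℝ}
    {μ M L : ℝ} (hM : 0 < M) (hW : IsMuSupersolution F q ϕ μ W₂) (hL : 0 < L)
    (hg₂ : LinearGrowth L W₂) {b c : ℝ} (hc0 : 0 ≤ c)
    {g gt : ℝ → EuclideanSpace ℝ (Fin d) → ℝ}
    {gx : ℝ → EuclideanSpace ℝ (Fin d) → EuclideanSpace ℝ (Fin d)}
    (hg : Continuous fun p : ℝ × EuclideanSpace ℝ (Fin d) => g p.1 p.2)
    (hgt : Continuous fun p : ℝ × EuclideanSpace ℝ (Fin d) => gt p.1 p.2)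
    (hgx : Continuous fun p : ℝ × EuclideanSpace ℝ (Fin d) => gx p.1 p.2)
    (ht : ∀ s x, HasDerivAt (fun r => g r x) (gt s x) s)
    (hx : ∀ s x, HasGradientAt (g s) (gx s x) x) (hg0 : ∀ s ≤ T, ∀ x, 0 ≤ g s x)
    {γ η : ContPath d T} (hη : η ∈ lipPaths d T μ γ.1.time M) (hγη : γ.1.time = η.1.time)
    (hmax : ∀ γ' ∈ lipPaths d T μ γ.1.time M, ∀ η' ∈ lipPaths d T μ γ.1.time M,
      γ'.1.time = η'.1.time →
      W₁ γ' - W₂ η' - (b ^ 2 * η'.1.sqDist γ'.1 +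
        c * ‖η'.1.toFun η'.1.time - γ'.1.toFun η'.1.time‖ ^ 2) -
          g η'.1.time (η'.1.toFun η'.1.time) ≤
      W₁ γ - W₂ η - (b ^ 2 * η.1.sqDist γ.1 +
        c * ‖η.1.toFun η.1.time - γ.1.toFun η.1.time‖ ^ 2) - g η.1.time (η.1.toFun η.1.time))
    (hηT : η.1.time < T) (hηM : ‖η.1.toFun η.1.time‖ < M) {v : EuclideanSpace ℝ (Fin d)}
    {a h₀ : ℝ} (hh₀ : 0 < h₀) (hv : ∀ t ∈ Icc γ.1.time (γ.1.time + h₀), t ≤ T →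
      extend γ v t ∈ lipPaths d T μ γ.1.time M ∧
      W₁ γ - (t - γ.1.time) * a ≤ W₁ (extend γ v t)) :
    hamiltonian F q η (-((2 * c) • (η.1.toFun η.1.time - γ.1.toFun η.1.time) +
      gx η.1.time (η.1.toFun η.1.time))) ≤
    b ^ 2 * ‖η.1.toFun η.1.time - γ.1.toFun η.1.time‖ ^ 2 -
      2 * c * inner ℝ (η.1.toFun η.1.time - γ.1.toFun η.1.time) v + a +
      gt η.1.time (η.1.toFun η.1.time) := by
  set τ := γ.1.time with hτ
  set c₀ := -W₂ η - (b ^ 2 * η.1.sqDist γ.1 +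
    c * ‖η.1.toFun η.1.time - γ.1.toFun η.1.time‖ ^ 2) - g η.1.time (η.1.toFun η.1.time) with hc₀
  -- After `τ + h₀` nothing is known of `W₁` along the extension. There the quadratic term, which
  -- has zero derivative at `τ`, dominates all others through the growth bound on `W₂`.
  set k := (|c₀| + |a| * T + L * (1 + M)) / h₀ ^ 2 with hk
  have hke : k * h₀ ^ 2 = |c₀| + |a| * T + L * (1 + M) := by rw [hk]; field_simp
  have hk0 : 0 ≤ k := by positivity
  have hφ := hasPathDerivsCont_penalty hT γ v (b ^ 2) c η.1.time
    (G := fun s x => g s x + (a * (s - τ) + k * (s - τ) ^ 2 + c₀))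
    (Gt := fun s x => gt s x + (a + k * (2 * (s - τ)))) (Gx := gx)
    (hg.add (by fun_prop)) (hgt.add (by fun_prop)) hgx
    (fun s x => by
      have h1 : HasDerivAt (fun s : ℝ => a * (s - τ)) a s := by
        simpa using ((hasDerivAt_id s).sub_const τ).const_mul a
      have h2 : HasDerivAt (fun s : ℝ => (s - τ) ^ 2) (2 * (s - τ)) s := by
        refine HasDerivAt.congr_deriv (((hasDerivAt_id s).sub_const τ).pow 2) (by simp)
      exact (ht s x).add ((h1.add (h2.const_mul k)).add_const c₀))
    (fun s x => by
      have h1 := (hx s x).hasFDerivAt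
      rw [hasGradientAt_iff_hasFDerivAt]
      exact h1.add_const _)
  have e : γ.1.toFun τ + (η.1.time - τ) • v = γ.1.toFun η.1.time := by
    rw [← hγη, sub_self, zero_smul, add_zero]
  have hη0 : η ∈ lipPaths d T μ 0 M := lipPaths_anti γ.1.time_mem.1 hη
  have key := hW.2 M hM η hη0 hηT hηM _ (mem_testBelow hφ hη (by
      rw [sqDist_extend_self hγη.symm, e, ← hγη, hc₀, ← hγη]
      ring) (fun ζ hζ => ?_)) _ _ hφ
  · rw [CadlagPath.endLeft_eq hηT, e] at key
    have e2 : (extend γ v T).1.toFun η.1.time = γ.1.toFun η.1.time := by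
      have h1 := extend_apply_eq (v := v) hγη.le hηT.le (le_refl η.1.time)
      rw [← h1, ← hγη, extend_self]
    have e3 : η.1.time - τ = 0 := sub_eq_zero.2 hγη.symm
    rw [e2, e3] at key
    linarith
  · have hζτ : τ ≤ ζ.1.time := hγη.le.trans hζ.1
    have hζT : ζ.1.time ≤ T := ζ.1.time_mem.2
    have hζ' : ζ ∈ lipPaths d T μ τ M := ⟨hζτ, hζ.2⟩
    have h0 := hg0 ζ.1.time hζT (ζ.1.toFun ζ.1.time)
    rcases le_total ζ.1.time (τ + h₀) with h | h
    -- The extension of `γ` to the final time of `ζ` is an admissible partner of `ζ`; the lower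
    -- bound along it eliminates `W₁`.
    · obtain ⟨h1, h2⟩ := hv ζ.1.time ⟨hζτ, h⟩ hζT
      have h3 := hmax _ h1 ζ hζ' (extend_time hζτ hζT)
      rw [sqDist_extend hζτ, extend_end hζτ hζT le_rfl, ← hτ] at h3
      have h4 : 0 ≤ k * (ζ.1.time - τ) ^ 2 := by positivity
      rw [hc₀]
      linarith
    · have h1 : k * h₀ ^ 2 ≤ k * (ζ.1.time - τ) ^ 2 :=
        mul_le_mul_of_nonneg_left (pow_le_pow_left₀ hh₀.le (by linarith) 2) hk0
      have h2 : -(|a| * T) ≤ a * (ζ.1.time - τ) := by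
        have h3 : |a * (ζ.1.time - τ)| ≤ |a| * T := by
          rw [abs_mul, abs_of_nonneg (sub_nonneg.2 hζτ)]
          exact mul_le_mul_of_nonneg_left (by linarith [γ.1.time_mem.1]) (abs_nonneg _)
        linarith [(abs_le.1 h3).1]
      have h4 := (abs_le.1 (hg₂.abs_le hL.le hζ)).1
      have h5 : 0 ≤ b ^ 2 * ζ.1.sqDist (extend γ v T).1 :=
        mul_nonneg (by positivity) (CadlagPath.sqDist_nonneg _ _)
      have h6 : 0 ≤ c * ‖ζ.1.toFun ζ.1.time - (γ.1.toFun τ + (ζ.1.time - τ) • v)‖ ^ 2 := by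
        positivity
      have h7 := neg_abs_le c₀
      linarith

section

variable {U : Type*} [MetricSpace U] {F : ContPath d T → U → EuclideanSpace ℝ (Fin d)}
  {q : ContPath d T → U → ℝ} {ϕ : TerminalPath d T → ℝ} {L₀ : ℝ}

/-- Combination of the sub- and supersolution properties at a maximum point with doubled paths. -/
theorem doubling_estimate [Nonempty U] (hT : 0 < T) (hL₀ : 0 < L₀) (hc : Coefficients F q ϕ L₀)
    {W₁ W₂ : ContPath d T → ℝ} {μ M L : ℝ} (hμ : L₀ ≤ μ) (hM : 0 < M)
    (hW₁ : IsMuSubsolution F q ϕ μ W₁) (hW₁c : Continuous W₁) (hL : 0 < L)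
    (hg₁ : LinearGrowth L W₁) (hl₁ : LocallyLipschitzBound L W₁)
    (hW : IsMuSupersolution F q ϕ μ W₂)
    (hg₂ : LinearGrowth L W₂) {b c ρ ε : ℝ} (hc0 : 0 ≤ c) (hε : 0 < ε)
    {g gt : ℝ → EuclideanSpace ℝ (Fin d) → ℝ}
    {gx : ℝ → EuclideanSpace ℝ (Fin d) → EuclideanSpace ℝ (Fin d)}
    (hg : Continuous fun p : ℝ × EuclideanSpace ℝ (Fin d) => g p.1 p.2)
    (hgt : Continuous fun p : ℝ × EuclideanSpace ℝ (Fin d) => gt p.1 p.2)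
    (hgx : Continuous fun p : ℝ × EuclideanSpace ℝ (Fin d) => gx p.1 p.2)
    (ht : ∀ s x, HasDerivAt (fun r => g r x) (gt s x) s)
    (hx : ∀ s x, HasGradientAt (g s) (gx s x) x) (hg0 : ∀ s ≤ T, ∀ x, 0 ≤ g s x)
    {γ η : ContPath d T} (hγ : γ ∈ lipPaths d T μ 0 M)
    (hη : η ∈ lipPaths d T μ γ.1.time M) (hγη : γ.1.time = η.1.time)
    (hmax : ∀ γ' ∈ lipPaths d T μ γ.1.time M, ∀ η' ∈ lipPaths d T μ γ.1.time M,
      γ'.1.time = η'.1.time →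
      W₁ γ' - W₂ η' - (b ^ 2 * η'.1.sqDist γ'.1 +
        c * ‖η'.1.toFun η'.1.time - γ'.1.toFun η'.1.time‖ ^ 2) -
          g η'.1.time (η'.1.toFun η'.1.time) ≤
      W₁ γ - W₂ η - (b ^ 2 * η.1.sqDist γ.1 +
        c * ‖η.1.toFun η.1.time - γ.1.toFun η.1.time‖ ^ 2) - g η.1.time (η.1.toFun η.1.time))
    (hηT : η.1.time < T) (hηM : ‖η.1.toFun η.1.time‖ < M) (hγM : ‖γ.1.toFun γ.1.time‖ < M)
    (hdrift : ∀ u, gt η.1.time (η.1.toFun η.1.time) +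
      inner ℝ (gx η.1.time (η.1.toFun η.1.time)) (F η u) ≤ -ρ) :
    ρ ≤ 2 * ε + b ^ 2 * ‖η.1.toFun η.1.time - γ.1.toFun η.1.time‖ ^ 2 +
      (2 * (c * ‖η.1.toFun η.1.time - γ.1.toFun η.1.time‖) + 1) * (L₀ * η.1.supDist γ.1) := by
  -- The control is nearly optimal at `η` but also drives `γ`, so only `F η u - F γ u` and `q η u -
  -- q γ u` remain.
  obtain ⟨u, hu⟩ := exists_lt_hamiltonian_add (F := F) (q := q) η
    (-((2 * c) • (η.1.toFun η.1.time - γ.1.toFun η.1.time) +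
      gx η.1.time (η.1.toFun η.1.time))) hε
  obtain ⟨h₀, hh₀, -, hh⟩ := hW₁.sub_le_extend hT hL₀ hc hμ hM hW₁c hL hg₁ hl₁ hγ
    (by rwa [hγη]) hγM u hε
  have key := hW.doubling_inequality hT hM hL hg₂ hc0 hg hgt hgx ht hx hg0 hη hγη hmax hηT hηM
    hh₀ fun t ht _ => hh t ht
  have h1 := hdrift u
  set D := η.1.toFun η.1.time - γ.1.toFun η.1.time with hD
  have h2 := (abs_le.1 (hc.lipschitz_q η γ u hγη.symm)).1
  have h3 : inner ℝ D (F η u - F γ u) ≤ ‖D‖ * (L₀ * η.1.supDist γ.1) :=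
    (real_inner_le_norm _ _).trans (mul_le_mul_of_nonneg_left
      (hc.lipschitz_F η γ u hγη.symm) (norm_nonneg _))
  have h4 := mul_le_mul_of_nonneg_left h3 (by positivity : 0 ≤ 2 * c)
  rw [inner_sub_right] at h4
  rw [inner_neg_left, inner_add_left, inner_smul_left] at hu
  simp only [conj_trivial] at hu
  linarith

set_option maxHeartbeats 1000000 in
/-- The comparison on a short time interval. -/
theorem le_of_le_later [Nonempty U] (hT : 0 < T) (hL₀ : 0 < L₀) (hc : Coefficients F q ϕ L₀)
    {W₁ W₂ : ContPath d T → ℝ} {μ L : ℝ} (hμ : L₀ ≤ μ)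
    (hW₁ : IsMuSubsolution F q ϕ μ W₁) (hW₂ : IsMuSupersolution F q ϕ μ W₂)
    (hW₁c : Continuous W₁) (hW₂c : Continuous W₂) (hL : 0 < L)
    (hg₁ : LinearGrowth L W₁) (hg₂ : LinearGrowth L W₂)
    (hl₁ : LocallyLipschitzBound L W₁) (hl₂ : LocallyLipschitzBound L W₂) {t₁ : ℝ}
    (hlater : ∀ γ : ContPath d T, t₁ ≤ γ.1.time → W₁ γ ≤ W₂ γ) {ξ : ContPath d T}
    {Λ : ℝ} (hξ : ∀ l r : ℝ, ‖ξ.1.toFun l - ξ.1.toFun r‖ ≤ Λ * |l - r|)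
    (hξt : t₁ - 1 / (8 * L₀) ≤ ξ.1.time) : W₁ ξ ≤ W₂ ξ := by
  by_contra hcon
  push Not at hcon
  set τ := ξ.1.time with hτ
  have hμ0 : 0 < μ := hL₀.trans_le hμ
  -- `15 ≤ M` gives `3/4 (1 + M)² ≤ (M - 1)²` for the cutoff, `2 ‖ξ‖₀ ≤ M` makes the cutoff vanish
  -- at `ξ`, and `Λ ≤ μ M` puts `ξ` in the compact class.
  obtain ⟨M, hM15, hMξ, hMΛ⟩ : ∃ M : ℝ, 15 ≤ M ∧ 2 * ξ.1.supNorm ≤ M ∧ Λ ≤ μ * M :=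
    ((eventually_ge_atTop 15).and ((eventually_ge_atTop _).and
      ((tendsto_id.const_mul_atTop hμ0).eventually_ge_atTop Λ))).exists
  have hM : 0 < M := by linarith
  have hK : 0 < μ * (1 + M) := by positivity
  have hξ0 := ξ.1.supNorm_nonneg
  have hξm : ξ ∈ lipPaths d T μ τ M := mem_lipPaths le_rfl
    (fun s => (ξ.1.norm_le_supNorm s).trans (by linarith)) fun l r =>
    (hξ l r).trans (mul_le_mul_of_nonneg_right (by linarith) (abs_nonneg _))
  obtain ⟨m, hm, hm0⟩ : ∃ m, m = W₁ ξ - W₂ ξ ∧ 0 < m := ⟨_, rfl, by linarith⟩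
  -- The term `ρ (T - s)` costs at most half of the excess `m`.
  obtain ⟨ρ, hρ, hρT⟩ : ∃ ρ : ℝ, 0 < ρ ∧ ρ * T = m / 2 :=
    ⟨m / 2 / T, by positivity, by field_simp⟩
  obtain ⟨C, hC⟩ : ∃ C, C = L * (1 + M) := ⟨_, rfl⟩
  have hC0 : 0 < C := by rw [hC]; positivity
  obtain ⟨C₂, hC₂⟩ : ∃ C₂, C₂ = 16 * (2 * (μ * (1 + M))) * C + 4 * C + 1 := ⟨_, rfl⟩
  have hC₂0 : 0 < C₂ := by rw [hC₂]; positivity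
  obtain ⟨N, hN, hNρ⟩ : ∃ N : ℝ, 1 ≤ N ∧ C * C₂ ≤ N * (ρ / 4) :=
    ((eventually_ge_atTop 1).and
      ((tendsto_id.atTop_mul_const (by positivity : 0 < ρ / 4)).eventually_ge_atTop _)).exists
  obtain ⟨Q, hQ⟩ : ∃ Q, Q = N * (C * C₂) + 1 := ⟨_, rfl⟩
  have hQ0 : 0 < Q := by rw [hQ]; positivity
  obtain ⟨b, hb, hb1, hb2, hb3⟩ : ∃ b : ℝ, 0 < b ∧ C₂ * C < b * (m / 2) ∧ C₂ < b * 1 ∧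
      C₂ * (L₀ * (2 * Q + 1)) < b * (ρ / 4) := by
    have h1 : ∀ x z : ℝ, 0 < z → ∀ᶠ b : ℝ in atTop, x < b * z := fun x z hz =>
      (tendsto_id.atTop_mul_const hz).eventually_gt_atTop x
    exact ((eventually_gt_atTop 0).and ((h1 _ _ (by positivity)).and ((h1 _ _ one_pos).and
      (h1 _ _ (by positivity))))).exists
  -- With height `32 C` the cutoff is at least `2 C ≥ W₁ γ - W₂ η` near the sphere. As `g` involves
  -- only `η`, it cancels when `(γ, η)` is compared with `(η, η)`.
  set g : ℝ → EuclideanSpace ℝ (Fin d) → ℝ := fun s x =>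
    ρ * (T - s) + growth (32 * C) (1 + M) (2 * L₀) τ s x with hg
  have hgc : Continuous fun p : ℝ × EuclideanSpace ℝ (Fin d) => g p.1 p.2 :=
    Continuous.add (by fun_prop) (continuous_growth _ _ _ _)
  set Ψ : ContPath d T × ContPath d T → ℝ := fun p => W₁ p.1 - W₂ p.2 -
    (b ^ 2 * p.2.1.sqDist p.1.1 +
      N * b * ‖p.2.1.toFun p.2.1.time - p.1.1.toFun p.1.1.time‖ ^ 2) -
      g p.2.1.time (p.2.1.toFun p.2.1.time) with hΨ
  set S : Set (ContPath d T × ContPath d T) :=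
    (lipPaths d T μ τ M ×ˢ lipPaths d T μ τ M) ∩ {p | p.1.1.time = p.2.1.time} with hS
  have hSc : IsCompact S :=
    ((isCompact_lipPaths hT hK.le).prod (isCompact_lipPaths hT hK.le)).inter_right
      (isClosed_eq (continuous_contPath_time.comp continuous_fst)
        (continuous_contPath_time.comp continuous_snd))
  have hΨc : Continuous Ψ := by
    have he : Continuous fun γ : ContPath d T => γ.1.toFun γ.1.time :=
      CadlagPath.continuous_end.comp continuous_subtype_val
    have h1 : Continuous fun p : ContPath d T × ContPath d T => p.2.1.sqDist p.1.1 :=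
      Continuous.comp (f := fun p : ContPath d T × ContPath d T => (p.2.1, p.1.1))
        CadlagPath.continuous_sqDist
        ((continuous_subtype_val.comp continuous_snd).prodMk
          (continuous_subtype_val.comp continuous_fst))
    have h2 : Continuous fun p : ContPath d T × ContPath d T =>
        p.2.1.toFun p.2.1.time - p.1.1.toFun p.1.1.time :=
      (he.comp continuous_snd).sub (he.comp continuous_fst)
    have h3 : Continuous fun p : ContPath d T × ContPath d T =>
        g p.2.1.time (p.2.1.toFun p.2.1.time) :=
      Continuous.comp (f := fun p : ContPath d T × ContPath d T =>
          (p.2.1.time, p.2.1.toFun p.2.1.time)) hgc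
        ((continuous_contPath_time.comp continuous_snd).prodMk (he.comp continuous_snd))
    exact (((hW₁c.comp continuous_fst).sub (hW₂c.comp continuous_snd)).sub
      ((h1.const_mul _).add ((h2.norm.pow 2).const_mul _))).sub h3
  obtain ⟨⟨γ, η⟩, ⟨⟨hγ, hη⟩, hγη⟩, hmaxS⟩ :=
    hSc.exists_isMaxOn ⟨(ξ, ξ), ⟨hξm, hξm⟩, rfl⟩ hΨc.continuousOn
  change γ.1.time = η.1.time at hγη
  change γ ∈ lipPaths d T μ τ M at hγ
  change η ∈ lipPaths d T μ τ M at hη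
  have hmax : ∀ γ' ∈ lipPaths d T μ τ M, ∀ η' ∈ lipPaths d T μ τ M,
      γ'.1.time = η'.1.time →
      W₁ γ' - W₂ η' - (b ^ 2 * η'.1.sqDist γ'.1 +
        N * b * ‖η'.1.toFun η'.1.time - γ'.1.toFun η'.1.time‖ ^ 2) -
          g η'.1.time (η'.1.toFun η'.1.time) ≤
      W₁ γ - W₂ η - (b ^ 2 * η.1.sqDist γ.1 +
        N * b * ‖η.1.toFun η.1.time - γ.1.toFun η.1.time‖ ^ 2) -
          g η.1.time (η.1.toFun η.1.time) := by
    intro γ' hγ' η' hη' h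
    have h1 : Ψ (γ', η') ≤ Ψ (γ, η) := hmaxS ⟨⟨hγ', hη'⟩, h⟩
    simp only [hΨ] at h1
    rwa [h, hγη] at h1
  set t := η.1.time with ht
  have htT : t ≤ T := η.1.time_mem.2
  have hτt : τ ≤ t := hη.1
  have hτ0 : 0 ≤ τ := ξ.1.time_mem.1
  have h00 : (0 : ℝ) ^ 2 = 0 := by norm_num
  have hg0 : ∀ s ≤ T, ∀ x, 0 ≤ g s x := fun s hs x =>
    add_nonneg (mul_nonneg hρ.le (by linarith)) (growth_nonneg (by positivity) _ _ _ _ _)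
  have hgt0 := hg0 t htT (η.1.toFun t)
  have hJ0 : 0 ≤ b ^ 2 * η.1.sqDist γ.1 :=
    mul_nonneg (by positivity) (CadlagPath.sqDist_nonneg _ _)
  have hE0 : 0 ≤ N * b * ‖η.1.toFun t - γ.1.toFun t‖ ^ 2 := by positivity
  have hstart : m / 2 ≤ W₁ γ - W₂ η - g t (η.1.toFun t) := by
    have h1 := hmax ξ hξm ξ hξm rfl
    rw [CadlagPath.sqDist_self, sub_self, norm_zero, h00, ← hτ, ← hm] at h1
    have h2 : g τ (ξ.1.toFun τ) ≤ m / 2 := by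
      simp only [hg]
      rw [growth_start (by linarith) (by linarith [ξ.1.norm_le_supNorm τ]), ← hρT]
      nlinarith
    linarith
  have hpen : b ^ 2 * η.1.sqDist γ.1 +
      N * b * ‖η.1.toFun η.1.time - γ.1.toFun η.1.time‖ ^ 2 ≤ C * η.1.supDist γ.1 := by
    have h1 := hmax η hη η hη rfl
    rw [CadlagPath.sqDist_self, sub_self, norm_zero, h00] at h1
    have h2 := (abs_le.1 (hl₁.abs_sub_le hL.le hη hγ)).1
    rw [dist_eq_supDist hγη.symm, ← hC] at h2
    linarith
  obtain ⟨hy, hD⟩ := penalty_estimates hK hη hγ hγη.symm hb hN hC0.le hpen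
  rw [← hC₂] at hy hD
  set y := η.1.supDist γ.1 with hydef
  have hy0 : 0 ≤ y := CadlagPath.supDist_nonneg _ _
  have hym : C * y < m / 2 := by
    refine lt_of_mul_lt_mul_left ?_ hb.le
    have h1 := mul_le_mul_of_nonneg_left hy hC0.le
    linarith
  have hy1 : y < 1 := lt_of_mul_lt_mul_left (hy.trans_lt hb2) hb.le
  have hyρ : y * (L₀ * (2 * Q + 1)) < ρ / 4 := by
    refine lt_of_mul_lt_mul_left ?_ hb.le
    have h1 := mul_le_mul_of_nonneg_right hy (by positivity : 0 ≤ L₀ * (2 * Q + 1))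
    linarith
  -- Otherwise `W₁ γ ≤ W₂ γ ≤ W₂ η + C y < W₂ η + m / 2`, against `hstart`.
  have htt₁ : t < t₁ := by
    by_contra h
    have h1 := hlater γ (by rw [hγη]; exact not_lt.1 h)
    have h2 := (abs_le.1 (hl₂.abs_sub_le hL.le hη hγ)).1
    rw [dist_eq_supDist hγη.symm, ← hC] at h2
    linarith
  have ht₁T : t < T := by
    by_contra h
    have h1 : γ.1.time = T := by rw [hγη]; exact le_antisymm htT (not_lt.1 h)
    have h2 := (hW₁.1 ⟨γ, h1⟩).trans (hW₂.1 ⟨γ, h1⟩)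
    have h3 := (abs_le.1 (hl₂.abs_sub_le hL.le hη hγ)).1
    rw [dist_eq_supDist hγη.symm, ← hC] at h3
    linarith
  -- The spare unit passes the strict bound on to `γ`, since `y < 1`.
  have hηM : ‖η.1.toFun t‖ < M - 1 := by
    by_contra h
    have h1 := le_growth (A := 32 * C) (R := 1 + M) (k := 2 * L₀) (t₀ := τ) (s := t)
      (M := M - 1) (by positivity) (by linarith) (by linarith) (by nlinarith) (not_lt.1 h) (by
        have h2 : 2 * L₀ * (t - τ) ≤ 2 * L₀ * (1 / (8 * L₀)) :=
          mul_le_mul_of_nonneg_left (by linarith) (by positivity)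
        have h3 : 2 * L₀ * (1 / (8 * L₀)) = 1 / 4 := by field_simp; norm_num
        linarith)
    have h2 := (abs_le.1 (hg₁.abs_le hL.le hγ)).2
    have h3 := (abs_le.1 (hg₂.abs_le hL.le hη)).1
    rw [← hC] at h2 h3
    have h4 : 0 ≤ ρ * (T - t) := mul_nonneg hρ.le (by linarith)
    simp only [hg] at hstart
    linarith
  have hγM : ‖γ.1.toFun γ.1.time‖ < M := by
    rw [hγη]
    have h1 := norm_sub_norm_le (γ.1.toFun t) (η.1.toFun t)
    have h2 := CadlagPath.norm_sub_le_supDist η.1 γ.1 t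
    rw [norm_sub_rev] at h2
    linarith
  have hτγ : τ ≤ γ.1.time := hγ.1
  have key := doubling_estimate (ρ := ρ) (ε := ρ / 8) (g := g) (b := b) (c := N * b)
    (gt := fun s x => -ρ + growthTime (32 * C) (1 + M) (2 * L₀) τ s x)
    (gx := fun s x => growthGrad (32 * C) (1 + M) (2 * L₀) τ s x)
    hT hL₀ hc hμ hM hW₁ hW₁c hL hg₁ hl₁ hW₂ hg₂ (by positivity) (by positivity) hgc
    (continuous_const.add (continuous_growthTime _ _ _ _)) (continuous_growthGrad _ _ _ _)
    (fun s x => HasDerivAt.add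
      (((hasDerivAt_id s).const_sub T).const_mul ρ |>.congr_deriv (by simp))
      (hasDerivAt_growth _ _ _ _ _ _))
    (fun s x => by
      have h1 := (hasGradientAt_growth (32 * C) (1 + M) (2 * L₀) τ s x).hasFDerivAt
      rw [hasGradientAt_iff_hasFDerivAt]
      exact h1.const_add _) hg0
    (lipPaths_anti hτ0 hγ) (⟨hγη.le, hη.2⟩ : η ∈ lipPaths d T μ γ.1.time M) hγη
    (fun γ' hγ' η' hη' => hmax γ' (lipPaths_anti hτγ hγ') η' (lipPaths_anti hτγ hη'))
    ht₁T (by linarith) hγM (fun u => by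
      have h1 := growthTime_add_inner_le (A := 32 * C) (R := 1 + M) (L₀ := L₀) (by positivity)
        (by linarith) τ t (x := η.1.toFun t) (f := F η u) (by linarith)
        ((hc.growth_F η u).trans (mul_le_mul_of_nonneg_left (by linarith [hη.2.1]) hL₀.le))
      linarith)
  change ρ ≤ 2 * (ρ / 8) + b ^ 2 * ‖η.1.toFun t - γ.1.toFun t‖ ^ 2 +
    (2 * (N * b * ‖η.1.toFun t - γ.1.toFun t‖) + 1) * (L₀ * y) at key
  change N * (b * ‖η.1.toFun t - γ.1.toFun t‖) ^ 2 ≤ C * C₂ at hD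
  set D := η.1.toFun t - γ.1.toFun t with hDdef
  have k1 : b ^ 2 * ‖D‖ ^ 2 ≤ ρ / 4 := by
    rw [← mul_pow]
    exact le_of_mul_le_mul_left (hD.trans hNρ) (by linarith)
  have k2 : N * b * ‖D‖ ≤ Q := by
    have h1 : (N * b * ‖D‖) ^ 2 ≤ N * (C * C₂) := by
      calc _ = N * (N * (b * ‖D‖) ^ 2) := by ring
        _ ≤ _ := mul_le_mul_of_nonneg_left hD (by linarith)
    have h2 := two_mul_le_add_sq (N * b * ‖D‖) 1
    have h3 := sq_nonneg (N * b * ‖D‖)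
    rw [hQ]
    linarith
  have k3 : (2 * (N * b * ‖D‖) + 1) * (L₀ * y) ≤ (2 * Q + 1) * (L₀ * y) :=
    mul_le_mul_of_nonneg_right (by linarith) (by positivity)
  -- The three terms on the right are `ρ / 4`, at most `ρ / 4`, and less than `ρ / 4`.
  linarith

end

end PHJB

/-! ### Backward induction in time. -/

theorem mainTheorem2 {d : ℕ} {T : ℝ} (hT : 0 < T)
    {U : Type*} [MetricSpace U] [Nonempty U]
    (F : PHJB.ContPath d T → U → EuclideanSpace ℝ (Fin d))
    (q : PHJB.ContPath d T → U → ℝ) (ϕ : PHJB.TerminalPath d T → ℝ)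
    (hyp : ∃ L₀ : ℝ, 0 < L₀ ∧ PHJB.Coefficients F q ϕ L₀)
    (W₁ W₂ : PHJB.ContPath d T → ℝ)
    (h₁ : PHJB.IsViscositySubsolution F q ϕ W₁)
    (h₂ : PHJB.IsViscositySupersolution F q ϕ W₂)
    (hW : ∃ L : ℝ, 0 < L ∧
      PHJB.LinearGrowth L W₁ ∧ PHJB.LinearGrowth L W₂ ∧
      PHJB.LocallyLipschitzBound L W₁ ∧ PHJB.LocallyLipschitzBound L W₂) :
    ∀ γ : PHJB.ContPath d T, W₁ γ ≤ W₂ γ := by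
  obtain ⟨L₀, hL₀, hc⟩ := hyp
  obtain ⟨L, hL, hg₁, hg₂, hl₁, hl₂⟩ := hW
  obtain ⟨hW₁c, μ₁, -, hμ₁⟩ := h₁
  obtain ⟨hW₂c, μ₂, -, hμ₂⟩ := h₂
  have hs₁ := hμ₁ (max L₀ (max μ₁ μ₂)) ((le_max_left _ _).trans (le_max_right _ _))
  have hs₂ := hμ₂ (max L₀ (max μ₁ μ₂)) ((le_max_right _ _).trans (le_max_right _ _))
  have hδ : 0 < 1 / (8 * L₀) := by positivity
  -- The step length depends neither on the path nor on its Lipschitz constant, so the Lipschitz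
  -- approximations of a path are all covered by the same step and the inequality passes to the
  -- limit.
  have key : ∀ n : ℕ, ∀ γ : PHJB.ContPath d T, T - n * (1 / (8 * L₀)) ≤ γ.1.time →
      W₁ γ ≤ W₂ γ := by
    intro n
    induction n with
    | zero =>
      intro γ hγ
      have h : γ.1.time = T := le_antisymm γ.1.time_mem.2 (by simpa using hγ)
      exact (hs₁.1 ⟨γ, h⟩).trans (hs₂.1 ⟨γ, h⟩)
    | succ n ih =>
      intro γ hγ
      have hcl : ∀ k : ℕ, ∃ η : PHJB.ContPath d T, dist η γ ≤ 1 / ((k : ℝ) + 1) ∧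
          W₁ η ≤ W₂ η := by
        intro k
        obtain ⟨η, hηt, hηd, K, -, hηK⟩ :=
          PHJB.exists_lipschitz_approx γ (ε := 1 / ((k : ℝ) + 1)) (by positivity)
        refine ⟨η, hηd, PHJB.le_of_le_later hT hL₀ hc (le_max_left _ _) hs₁ hs₂ hW₁c hW₂c hL
          hg₁ hg₂ hl₁ hl₂ ih hηK ?_⟩
        rw [hηt]
        push_cast at hγ
        linarith
      choose η hηd hη using hcl
      have hlim : Filter.Tendsto η Filter.atTop (nhds γ) :=
        tendsto_iff_dist_tendsto_zero.2 (squeeze_zero (fun _ => dist_nonneg) hηd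
          (tendsto_one_div_add_atTop_nhds_zero_nat (𝕜 := ℝ)))
      exact le_of_tendsto_of_tendsto' ((hW₁c.tendsto γ).comp hlim) ((hW₂c.tendsto γ).comp hlim) hη
  intro γ
  obtain ⟨n, hn⟩ := exists_nat_ge (T / (1 / (8 * L₀)))
  refine key n γ ?_
  rw [div_le_iff₀ hδ] at hn
  linarith [γ.1.time_mem.1]
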